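/- **Setting.** Let $n\ge 1$, $0<T\le\infty$, $Q_T=\mathbb R^n\times[0,T)$. Let $\mathcal B=(1-\Delta)^{-1}$, i.e. $\mathcal B g=\int_{\mathbb R^n}B(x-y)g(y)\,dy$ with $B(x)=(2\pi)^{-n/2}|x|^{1-n/2}K_{n/2-1}(|x|)$, where $K_\nu$ is the modified Bessel function of the second kind. Let $\mathcal E=\bigcup_{0\le\rho<1}\mathcal E_\rho$, $\mathcal E_\rho=L^1(\mathbb R^n,e^{-\rho|x|}dx)$, with the inductive limit topology; thus $u\in C([0,T);\mathcal E)$ means that for every $b<T$ there is $\rho\in[0,1)$ with $u\in C([0,b];\mathcal E_\rho)$. A *solution on $Q_T$* of $$\partial_tu-\Delta\partial_tu=\Delta u+a(x,t)u,\qquad u(\cdot,0)=u_0 \tag{1}$$ is a function $u\in C([0,T);\mathcal E)$ such that $\mu:=e^tu$ satisfies $$\mu(t)=u_0+\int_0^t\mathcal B\big((a(\cdot,\tau)+1)\mu(\tau)\big)\,d\tau\quad\text{on }Q_T, \tag{2}$$ with convergent integrals. It is *global* if $T=\infty$. For $a\ge0$, an *extended nonnegative solution on $Q_T$* is a function $u:Q_T\to[0,\infty]$,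 measurable in $x$, such that (2) holds in $[0,\infty]$ at every point of $Q_T$; it *blows up completely on $Q_T$* if $u(x,t)=\infty$ for all $x\in\mathbb R^n$ and $0<t<T$. **Hypotheses.** Assume that $a\ge 0$ on $\mathbb R^n\times(0,\infty)$ and that $$a(x,t)\ge\Lambda(t)|x|^\sigma\quad\text{for all }|x|\ge R_0,\ t>0,$$ where $\sigma\in\mathbb R$ and $R_0\ge0$ are constants, and $\Lambda>0$ is measurable on $(0,\infty)$ and bounded on $(0,b]$ for every $b<\infty$. Assume that $u_0>0$ on $\mathbb R^n$ and that, for some $\alpha\le1$ and $\delta\in\mathbb R$, with $\delta<1$ if $\alpha=1$, there is $R>0$ such that $$\frac{\log u_0(x)}{|x|^\alpha}\ge\delta\quad\text{for }|x|\ge R.$$ Put $\Lambda_*(t)=\int_0^t\Lambda(s)\,ds$, $c_\tau=\min\Big\{1,\dfrac{R_0^{-\sigma}}{\|\Lambda\|_{L^\infty(0,\tau)}}\Big\}$ (so $c_\tau=1$ if $R_0=0<\sigma$), and $\delta_-=\min\{\delta,0\}$. **Theorem.** (i) (Instantaneous blow-up) If $\sigma>1$, then for every $0<T\le\infty$ equation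 (1) has no nonnegative solution on $Q_T$. In fact, every extended nonnegative solution on $Q_T$ blows up completely on $Q_T$. (ii) (Nonexistence of global solutions) If $\sigma=1$ and $$\sup_{\tau>0}c_\tau\Lambda_*(\tau)>\begin{cases}1&\text{if }\alpha<1,\\ 1-\delta_-&\text{if }\alpha=1,\end{cases}$$ then (1) has no nonnegative global solution. (Since $u_0>0$, every solution of (1) is automatically nontrivial.) -/

import Mathlib

open MeasureTheory Set Filter Topology

noncomputable section

namespace Pseudoparabolic

/-- The Euclidean space `ℝⁿ`. -/
abbrev Space (n : ℕ) : Type := EuclideanSpace ℝ (Fin n)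

/-- The modified Bessel function of the second kind `K_ν(r)`, for `r > 0`, by the integral formula
`K_ν(r) = ½ (r/2)^ν ∫₀^∞ exp(-s - r²/(4s)) s^(-ν-1) ds`. -/
def besselK (ν r : ℝ) : ℝ :=
  1 / 2 * (r / 2) ^ ν * ∫ s in Ioi (0 : ℝ), Real.exp (-s - r ^ 2 / (4 * s)) * s ^ (-ν - 1)

/-- The kernel `B(x) = (2π)^(-n/2) |x|^(1-n/2) K_{n/2-1}(|x|)` of `(1 - Δ)⁻¹` on `ℝⁿ`
(its Fourier multiplier is `(1 + |ξ|²)⁻¹`; the value at `x = 0` is irrelevant). -/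
def besselKernel {n : ℕ} (x : Space n) : ℝ :=
  (2 * Real.pi) ^ (-((n : ℝ) / 2)) *
    (‖x‖ ^ (1 - (n : ℝ) / 2) * besselK ((n : ℝ) / 2 - 1) ‖x‖)

/-- The Bessel potential operator `𝓑 = (1 - Δ)⁻¹`, `𝓑 g (x) = ∫ B(x - y) g(y) dy`; meaningful
where the integrand is integrable, which is demanded wherever the operator is used. -/
def besselOp {n : ℕ} (g : Space n → ℝ) (x : Space n) : ℝ :=
  ∫ y, besselKernel (x - y) * g y

/-- The time interval `[0, T)`, where `T ≤ ∞`. -/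
def timeInterval (T : EReal) : Set ℝ := {t | 0 ≤ t ∧ (t : EReal) < T}

/-- The weighted space `𝓔_ρ = L¹(ℝⁿ, e^{-ρ|x|})`. -/
def weightedL1 (n : ℕ) (ρ : ℝ) : Set (Space n → ℝ) :=
  {g | Integrable (fun x => Real.exp (-ρ * ‖x‖) * g x)}

/-- `u ∈ C([0,T); 𝓔)` for the inductive limit `𝓔 = ⋃_{0 ≤ ρ < 1} 𝓔_ρ`: on each compact time
interval `[0, b] ⊆ [0, T)`, `u` is a continuous curve in one of the spaces `𝓔_ρ`. -/
def ContinuousInE {n : ℕ} (T : EReal) (u : ℝ → Space n → ℝ) : Prop :=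
  ∀ b ∈ timeInterval T, ∃ ρ : ℝ, 0 ≤ ρ ∧ ρ < 1 ∧
    (∀ t ∈ Icc 0 b, u t ∈ weightedL1 n ρ) ∧
    ∀ t ∈ Icc 0 b,
      Tendsto (fun s => ∫ x, Real.exp (-ρ * ‖x‖) * |u s x - u t x|) (𝓝[Icc 0 b] t) (𝓝 0)

/-- `u` is a solution on `Q_T = ℝⁿ × [0,T)` of
`∂ₜu - Δ∂ₜu = Δu + a(x,t) u`, `u(·,0) = u₀`: it belongs to `C([0,T); 𝓔)`, and `μ = eᵗ u`
satisfies `μ(t) = u₀ + ∫₀ᵗ 𝓑((a(·,τ) + 1) μ(τ)) dτ` on `Q_T`, with convergent integrals. -/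
structure IsSolution {n : ℕ} (a : Space n → ℝ → ℝ) (u₀ : Space n → ℝ) (T : EReal)
    (u : ℝ → Space n → ℝ) : Prop where
  continuous : ContinuousInE T u
  mild : ∀ t ∈ timeInterval T, ∀ᵐ x : Space n,
    (∀ᵐ τ ∂(volume.restrict (Ioo 0 t)),
      Integrable (fun y => besselKernel (x - y) * ((a y τ + 1) * (Real.exp τ * u τ y)))) ∧
    IntegrableOn (fun τ => besselOp (fun y => (a y τ + 1) * (Real.exp τ * u τ y)) x) (Ioo 0 t) ∧
    Real.exp t * u t x =
      u₀ x + ∫ τ in Ioo 0 t, besselOp (fun y => (a y τ + 1) * (Real.exp τ * u τ y)) x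

/-- `u ≥ 0` on `Q_T`. -/
def IsNonneg {n : ℕ} (T : EReal) (u : ℝ → Space n → ℝ) : Prop :=
  ∀ t ∈ timeInterval T, ∀ᵐ x : Space n, 0 ≤ u t x

/-- A nonnegative solution on `Q_T` that is allowed to take the value `+∞`, for a nonnegative
potential `a` and nonnegative `u₀`: the same integral equation, read in `[0, ∞]`. -/
structure IsExtendedSolution {n : ℕ} (a : Space n → ℝ → ℝ) (u₀ : Space n → ℝ) (T : EReal)
    (U : ℝ → Space n → ENNReal) : Prop where
  measurable : ∀ t ∈ timeInterval T, AEMeasurable (U t)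
  mild : ∀ t ∈ timeInterval T, ∀ x : Space n,
    ENNReal.ofReal (Real.exp t) * U t x =
      ENNReal.ofReal (u₀ x) + ∫⁻ τ in Ioo 0 t, ∫⁻ y : Space n,
        ENNReal.ofReal (besselKernel (x - y) * (a y τ + 1)) *
          (ENNReal.ofReal (Real.exp τ) * U τ y)

/-- Complete (instantaneous) blow-up on `Q_T`: `U = +∞` at every point of `ℝⁿ × (0,T)`. -/
def BlowsUpCompletely {n : ℕ} (T : EReal) (U : ℝ → Space n → ENNReal) : Prop :=
  ∀ t ∈ timeInterval T, 0 < t → ∀ x : Space n, U t x = ⊤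

/-- The growth hypothesis on the potential: `a(x,t) ≥ Λ(t)|x|^σ` for all `|x| ≥ R₀`, `t > 0`,
with `Λ` positive, measurable and locally bounded (bounded on each `(0, b]`). -/
structure PotentialGrowth {n : ℕ} (a : Space n → ℝ → ℝ) (Λ : ℝ → ℝ) (σ R₀ : ℝ) : Prop where
  aemeasurable : AEMeasurable Λ (volume.restrict (Ioi 0))
  pos : ∀ t, 0 < t → 0 < Λ t
  locallyBounded : ∀ b, ∃ M, ∀ t ∈ Ioc 0 b, Λ t ≤ M
  bound : ∀ t, 0 < t → ∀ x : Space n, R₀ ≤ ‖x‖ → Λ t * ‖x‖ ^ σ ≤ a x t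

/-- `log u₀ / |x|^α ≥ δ` on some set `{|x| ≥ R}`, `R > 0`. -/
def InitialGrowth {n : ℕ} (u₀ : Space n → ℝ) (α δ : ℝ) : Prop :=
  ∃ R : ℝ, 0 < R ∧ ∀ᵐ x : Space n, R ≤ ‖x‖ → δ ≤ Real.log (u₀ x) / ‖x‖ ^ α

/-- `Λ_*(t) = ∫₀ᵗ Λ`. -/
def primitiveΛ (Λ : ℝ → ℝ) (t : ℝ) : ℝ := ∫ s in Ioo 0 t, Λ s

/-- `c_T = min {1, R₀^(-σ) / ‖Λ‖_{L^∞(0,T)}}`, with `c_T = 1` if `R₀ = 0 < σ`. -/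
def cConst (Λ : ℝ → ℝ) (σ R₀ T : ℝ) : ENNReal :=
  min 1 (ENNReal.ofReal (R₀ ^ σ) * eLpNorm Λ ⊤ (volume.restrict (Ioo 0 T)))⁻¹

/-- The threshold: `1` if `α < 1`, and `1 - δ₋` if `α = 1`, where `δ₋ = min {δ, 0}`. -/
def threshold (α δ : ℝ) : ℝ := if α < 1 then 1 else 1 - min δ 0

end Pseudoparabolic

end

/-!
# Blow-up for a pseudoparabolic equation with a growing potential

For a nonnegative solution `u` the function `m = eᵗ u` satisfies `m(t) ≥ u₀ + ∫₀ᵗ 𝓑((a + 1) m)`,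
and everything follows from this inequality, read in `[0, ∞]` (`IsSupersolution`). The operator
`𝓑` averages over a probability measure, the mixture of the Gaussian measures of variance `2s` with
weight `e⁻ˢ ds` (`besselMeasure`), which is even and has an exponential moment.

Let `q(x) = (|x| - R)₊`. For `σ = 1` and large `R` one has `a + 1 ≥ f(t) q` with `f = Λ`; for
`σ > 1` the same holds with `f = A Λ` for any `A`, if `R` is large depending on `A`. The datum
satisfies `u₀ ≥ exp (-η |x|)` for `|x| ≥ R`, so it lies above a small multiple of
`q^k exp (-ω √(M² + |x|²))`, for any `ω > η` and any `k` and `M`.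

The central estimate is that `𝓑` reproduces these profiles from below up to a factor as close to `1`
as desired, uniformly in all large `k`, provided that `M` is large
(`exists_profile_le_lintegral`). It rests on the convexity of `(p, r) ↦ pᵏ⁺¹ r⁻ᵏ`: with
`r = exp ((ω / k) √(M² + |x|²))`, averaging does not decrease `p = q`, which is convex, and
increases `r` by a factor `1 + O((ω / k) (1 / M + ω / k))` only.

Picard iteration then gives `m(t) ≥ c lʲ F(t)ʲ / j! · q^(k+j) exp (-ω √(M² + |x|²))`, with
`F(t) = ∫₀ᵗ f` and `l < 1` close to `1` (`IsSupersolution.profile_le`). The integral of the right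
side against `exp (-κ |x|)` is at least a constant times `(l F(t) / (κ + ω))ʲ`. Letting `j → ∞`,
`∫ exp (-κ |x|) m(t) = ∞` as soon as `F(t) > κ + η` (`IsSupersolution.lintegral_exp_eq_top`).

* If `σ = 1`, take `κ = 1`: membership of `u(t)` in one of the spaces `𝓔_ρ`, `ρ < 1`, is violated
  at a time `t` with `Λ_*(t) > 1 + η`. The constants `c_τ ≤ 1` only strengthen the hypothesis.
* If `σ > 1`, then `A` is arbitrary, so the integral is infinite for every `κ` and every `t > 0`.
  With `κ = 2` and `B(z) ≥ c exp (-2 |z|)`, the integral equation yields `m = ∞` everywhere.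
-/

noncomputable section

namespace Pseudoparabolic

/-! ### Iterated time integrals -/

/-- The recursion for iterated time integrals, `∫₀ᵗ f Fʲ = F(t)ʲ⁺¹ / (j + 1)` for `F(t) = ∫₀ᵗ f`.
As `f` is merely integrable, this is the fundamental theorem of calculus for the absolutely
continuous function `Fʲ⁺¹`. -/
theorem intervalIntegral_mul_primitive_pow {f : ℝ → ℝ} {t : ℝ}
    (hf : IntervalIntegrable f volume 0 t) (j : ℕ) :
    ∫ s in (0 : ℝ)..t, f s * (∫ r in (0 : ℝ)..s, f r) ^ j =
      (∫ r in (0 : ℝ)..t, f r) ^ (j + 1) / (j + 1) := by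
  set F : ℝ → ℝ := fun s => ∫ r in (0 : ℝ)..s, f r with hF
  have hac : AbsolutelyContinuousOnInterval F 0 t :=
    hf.absolutelyContinuousOnInterval_intervalIntegral left_mem_uIcc
  have hpow : ∀ k : ℕ, AbsolutelyContinuousOnInterval (fun s => F s ^ (k + 1)) 0 t := by
    intro k
    induction k with
    | zero => simpa using hac
    | succ k ih =>
      have := ih.fun_mul hac
      simpa only [← pow_succ] using this
  have h1 := (hpow j).integral_deriv_eq_sub
  have h2 : ∀ᵐ s, s ∈ uIcc 0 t → HasDerivAt F (f s) s := by
    have := hf.ae_hasDerivAt_integral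
    filter_upwards [this] with s hs hs'
    exact hs hs' 0 left_mem_uIcc
  have h3 : ∫ s in (0 : ℝ)..t, deriv (fun s => F s ^ (j + 1)) s =
      ∫ s in (0 : ℝ)..t, ((j : ℝ) + 1) * (f s * F s ^ j) := by
    apply intervalIntegral.integral_congr_ae
    filter_upwards [h2] with s hs hs'
    have := ((hs (uIoc_subset_uIcc hs')).pow (j + 1)).deriv
    simp only [Nat.add_sub_cancel, Nat.cast_add, Nat.cast_one] at this
    calc _ = deriv (F ^ (j + 1)) s := rfl
      _ = _ := by rw [this]; ring
  rw [h3, intervalIntegral.integral_const_mul] at h1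
  have h0 : F 0 = 0 := by simp [hF]
  rw [h0] at h1
  have : (j : ℝ) + 1 ≠ 0 := by positivity
  rw [eq_div_iff this, mul_comm]
  simpa using h1

/-! ### The Bessel kernel as a probability density -/

/-- `(4πs)^(-n/2) exp(-s - |z|²/(4s))`: the heat kernel at time `s`, weighted by `e⁻ˢ`. -/
def heatWeight {n : ℕ} (z : Space n) (s : ℝ) : ℝ :=
  (4 * Real.pi * s) ^ (-((n : ℝ) / 2)) * Real.exp (-s - ‖z‖ ^ 2 / (4 * s))

/-- The Bessel kernel in `[0, ∞]`, as the mixture of heat kernels `∫₀^∞ e⁻ˢ G_s ds`. -/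
def heatMixture {n : ℕ} (z : Space n) : ENNReal :=
  ∫⁻ s in Ioi (0 : ℝ), ENNReal.ofReal (heatWeight z s)

/-- The measure with density the Bessel kernel. -/
def besselMeasure (n : ℕ) : Measure (Space n) := volume.withDensity heatMixture

theorem measurable_heatWeight {n : ℕ} :
    Measurable (fun p : Space n × ℝ => heatWeight p.1 p.2) := by
  unfold heatWeight
  fun_prop

theorem measurable_heatMixture {n : ℕ} : Measurable (heatMixture (n := n)) := by
  unfold heatMixture
  exact (measurable_heatWeight.ennreal_ofReal).lintegral_prod_right'

theorem heatWeight_nonneg {n : ℕ} (z : Space n) {s : ℝ} (hs : 0 < s) : 0 ≤ heatWeight z s := by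
  unfold heatWeight
  have := Real.pi_pos
  positivity

theorem heatMixture_neg {n : ℕ} (z : Space n) : heatMixture (-z) = heatMixture z := by
  simp [heatMixture, heatWeight]

theorem besselKernel_eq_integral_heatWeight {n : ℕ} {z : Space n} (hz : z ≠ 0) :
    besselKernel z = ∫ s in Ioi (0 : ℝ), heatWeight z s := by
  have hr : 0 < ‖z‖ := norm_pos_iff.mpr hz
  have hpi := Real.pi_pos
  unfold besselKernel besselK
  set r := ‖z‖
  have e1 : ∀ s ∈ Ioi (0 : ℝ), heatWeight z s = (4 * Real.pi) ^ (-((n : ℝ) / 2)) *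
      (Real.exp (-s - r ^ 2 / (4 * s)) * s ^ (-((n : ℝ) / 2 - 1) - 1)) := by
    intro s hs
    have hs' : 0 < s := hs
    have : -((n : ℝ) / 2 - 1) - 1 = -((n : ℝ) / 2) := by ring
    rw [this, heatWeight, Real.mul_rpow (by positivity) hs'.le]
    ring
  rw [setIntegral_congr_fun measurableSet_Ioi e1, integral_const_mul]
  have e2 : (2 * Real.pi) ^ (-((n : ℝ) / 2)) *
      (r ^ (1 - (n : ℝ) / 2) * (1 / 2 * (r / 2) ^ ((n : ℝ) / 2 - 1))) =
      (4 * Real.pi) ^ (-((n : ℝ) / 2)) := by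
    rw [Real.div_rpow hr.le (by norm_num)]
    have h1 : r ^ (1 - (n : ℝ) / 2) * r ^ ((n : ℝ) / 2 - 1) = 1 := by
      rw [← Real.rpow_add hr]; simp
    have h2 : (1 / 2 : ℝ) / 2 ^ ((n : ℝ) / 2 - 1) = 2 ^ (-((n : ℝ) / 2)) := by
      rw [Real.rpow_sub_one (by norm_num), Real.rpow_neg (by norm_num)]
      field_simp
    calc _ = (2 * Real.pi) ^ (-((n : ℝ) / 2)) *
        ((1 / 2 : ℝ) / 2 ^ ((n : ℝ) / 2 - 1)) *
          (r ^ (1 - (n : ℝ) / 2) * r ^ ((n : ℝ) / 2 - 1)) := by ring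
      _ = _ := by
        rw [h1, h2, mul_one, ← Real.mul_rpow (by positivity) (by norm_num)]
        congr 1; ring
  rw [← e2]
  ring

/-- Integration against the Bessel measure is a mixture of Gaussian integrals. -/
theorem lintegral_besselMeasure {n : ℕ} {g : Space n → ENNReal} (hg : Measurable g) :
    ∫⁻ z, g z ∂besselMeasure n =
      ∫⁻ s in Ioi (0 : ℝ), ∫⁻ z, ENNReal.ofReal (heatWeight z s) * g z := by
  rw [besselMeasure, lintegral_withDensity_eq_lintegral_mul _ measurable_heatMixture hg]
  simp only [Pi.mul_apply, heatMixture]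
  rw [lintegral_lintegral_swap]
  · refine lintegral_congr fun z => ?_
    rw [lintegral_mul_const]
    exact (measurable_heatWeight.comp (measurable_const.prodMk measurable_id)).ennreal_ofReal
  · apply Measurable.aemeasurable
    refine Measurable.mul ?_ (hg.comp measurable_snd)
    exact (measurable_heatWeight.comp (measurable_snd.prodMk measurable_fst)).ennreal_ofReal

theorem lintegral_exp_neg_mul_sq_norm {n : ℕ} {b : ℝ} (hb : 0 < b) :
    ∫⁻ z : Space n, ENNReal.ofReal (Real.exp (-b * ‖z‖ ^ 2)) =
      ENNReal.ofReal ((Real.pi / b) ^ ((n : ℝ) / 2)) := by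
  have h := GaussianFourier.integral_rexp_neg_mul_sq_norm (V := Space n) hb
  rw [finrank_euclideanSpace_fin] at h
  have hi : Integrable (fun z : Space n => Real.exp (-b * ‖z‖ ^ 2)) := by
    by_contra hcon
    rw [integral_undef hcon] at h
    have : 0 < (Real.pi / b) ^ ((n : ℝ) / 2) := by
      have := Real.pi_pos
      positivity
    linarith
  rw [← ofReal_integral_eq_lintegral_ofReal hi (ae_of_all _ fun z => (Real.exp_pos _).le), h]

theorem lintegral_Ioi_exp_neg_mul {b : ℝ} (hb : 0 < b) :
    ∫⁻ s in Ioi (0 : ℝ), ENNReal.ofReal (Real.exp (-b * s)) = ENNReal.ofReal (1 / b) := by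
  have hi := exp_neg_integrableOn_Ioi 0 hb
  rw [← ofReal_integral_eq_lintegral_ofReal hi (ae_of_all _ fun z => (Real.exp_pos _).le)]
  rw [integral_exp_mul_Ioi (by linarith)]
  simp

instance isProbabilityMeasure_besselMeasure (n : ℕ) : IsProbabilityMeasure (besselMeasure n) := by
  constructor
  have h := lintegral_besselMeasure (n := n) (g := fun _ => 1) measurable_const
  rw [lintegral_one] at h
  rw [h]
  have hpi := Real.pi_pos
  have : ∀ s ∈ Ioi (0 : ℝ), ∫⁻ z : Space n, ENNReal.ofReal (heatWeight z s) * 1 =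
      ENNReal.ofReal (Real.exp (-1 * s)) := by
    intro s hs
    have hs : 0 < s := hs
    have e : ∀ z : Space n, ENNReal.ofReal (heatWeight z s) * 1 =
        ENNReal.ofReal ((4 * Real.pi * s) ^ (-((n : ℝ) / 2)) * Real.exp (-1 * s)) *
          ENNReal.ofReal (Real.exp (-(1 / (4 * s)) * ‖z‖ ^ 2)) := by
      intro z
      rw [← ENNReal.ofReal_mul (by positivity), mul_one, heatWeight,
        mul_assoc (_ ^ _) (Real.exp _) (Real.exp _), ← Real.exp_add]
      congr 3
      ring
    simp_rw [e]
    rw [lintegral_const_mul' _ _ ENNReal.ofReal_ne_top, lintegral_exp_neg_mul_sq_norm (by positivity),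
      ← ENNReal.ofReal_mul (by positivity)]
    congr 1
    have : Real.pi / (1 / (4 * s)) = 4 * Real.pi * s := by field_simp
    rw [this, Real.rpow_neg (by positivity)]
    have : (4 * Real.pi * s) ^ ((n : ℝ) / 2) ≠ 0 := by positivity
    field_simp
  rw [setLIntegral_congr_fun measurableSet_Ioi this, lintegral_Ioi_exp_neg_mul one_pos]
  simp

theorem heatMixture_ne_top_ae {n : ℕ} : ∀ᵐ z : Space n, heatMixture z ≠ ⊤ := by
  have h : ∫⁻ z : Space n, heatMixture z ≠ ⊤ := by
    have := measure_ne_top (besselMeasure n) univ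
    rwa [besselMeasure, withDensity_apply _ MeasurableSet.univ, Measure.restrict_univ] at this
  filter_upwards [ae_lt_top measurable_heatMixture h] with z hz using hz.ne

theorem ofReal_besselKernel_ae {n : ℕ} (hn : 0 < n) :
    ∀ᵐ z : Space n, ENNReal.ofReal (besselKernel z) = heatMixture z := by
  have : Nonempty (Fin n) := ⟨⟨0, hn⟩⟩
  have h0 : ∀ᵐ z : Space n, z ≠ 0 := by
    rw [ae_iff]; simp
  filter_upwards [heatMixture_ne_top_ae, h0] with z hz hz0
  rw [besselKernel_eq_integral_heatWeight hz0, integral_eq_lintegral_of_nonneg_ae]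
  · exact ENNReal.ofReal_toReal hz
  · filter_upwards [ae_restrict_mem measurableSet_Ioi] with s hs using heatWeight_nonneg z hs
  · exact (measurable_heatWeight.comp (measurable_const.prodMk measurable_id)).aestronglyMeasurable

theorem besselKernel_nonneg {n : ℕ} (z : Space n) : 0 ≤ besselKernel z := by
  unfold besselKernel besselK
  have hpi := Real.pi_pos
  have : 0 ≤ ∫ s in Ioi (0 : ℝ),
      Real.exp (-s - ‖z‖ ^ 2 / (4 * s)) * s ^ (-((n : ℝ) / 2 - 1) - 1) :=
    setIntegral_nonneg measurableSet_Ioi fun s hs => by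
      have : 0 < s := hs
      positivity
  positivity

theorem lintegral_besselMeasure_neg {n : ℕ} (g : Space n → ENNReal) (hg : Measurable g) :
    ∫⁻ z, g (-z) ∂besselMeasure n = ∫⁻ z, g z ∂besselMeasure n := by
  have hg' : Measurable fun z => g (-z) := hg.comp measurable_neg
  rw [besselMeasure, lintegral_withDensity_eq_lintegral_mul _ measurable_heatMixture hg,
    lintegral_withDensity_eq_lintegral_mul _ measurable_heatMixture hg']
  rw [← lintegral_neg_eq_self (μ := volume) (f := (heatMixture * g : Space n → ENNReal))]
  simp [heatMixture_neg]

/-- The convolution with the Bessel kernel is the average over the Bessel measure. -/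
theorem lintegral_besselKernel_mul {n : ℕ} (hn : 0 < n) (x : Space n) (g : Space n → ENNReal)
    (hg : Measurable g) :
    ∫⁻ y, ENNReal.ofReal (besselKernel (x - y)) * g y = ∫⁻ z, g (x - z) ∂besselMeasure n := by
  have hqp := (Measure.measurePreserving_sub_left (volume : Measure (Space n)) x)
  have hg' : Measurable fun z : Space n => g (x - z) := hg.comp (measurable_const.sub measurable_id)
  rw [besselMeasure, lintegral_withDensity_eq_lintegral_mul _ measurable_heatMixture hg',
    ← hqp.lintegral_comp (measurable_heatMixture.mul hg')]
  refine lintegral_congr_ae ?_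
  filter_upwards [hqp.quasiMeasurePreserving.ae (ofReal_besselKernel_ae hn)] with y hy
  simp [hy]

/-- The Bessel measure has an exponential moment. -/
theorem lintegral_exp_norm_besselMeasure_ne_top (n : ℕ) :
    ∫⁻ z, ENNReal.ofReal (Real.exp (‖z‖ / 2)) ∂besselMeasure n ≠ ⊤ := by
  rw [lintegral_besselMeasure (by fun_prop)]
  have hpi := Real.pi_pos
  have key : ∀ s ∈ Ioi (0 : ℝ), ∫⁻ z : Space n, ENNReal.ofReal (heatWeight z s) *
      ENNReal.ofReal (Real.exp (‖z‖ / 2)) ≤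
      ENNReal.ofReal (2 ^ ((n : ℝ) / 2)) * ENNReal.ofReal (Real.exp (-(1 / 2) * s)) := by
    intro s hs
    have hs : 0 < s := hs
    have e : ∀ z : Space n, ENNReal.ofReal (heatWeight z s) * ENNReal.ofReal (Real.exp (‖z‖ / 2)) ≤
        ENNReal.ofReal ((4 * Real.pi * s) ^ (-((n : ℝ) / 2)) * Real.exp (-(1 / 2) * s)) *
          ENNReal.ofReal (Real.exp (-(1 / (8 * s)) * ‖z‖ ^ 2)) := by
      intro z
      rw [← ENNReal.ofReal_mul (heatWeight_nonneg z hs), ← ENNReal.ofReal_mul (by positivity),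
        heatWeight, mul_assoc (_ ^ _) (Real.exp _) (Real.exp _), ← Real.exp_add,
        mul_assoc (_ ^ _) (Real.exp _) (Real.exp _), ← Real.exp_add]
      refine ENNReal.ofReal_le_ofReal
        (mul_le_mul_of_nonneg_left (Real.exp_le_exp.mpr ?_) (by positivity))
      -- Young's inequality `|z|/2 ≤ |z|²/(8s) + s/2`
      have : 0 ≤ (‖z‖ - 2 * s) ^ 2 / (8 * s) := by positivity
      have h2 : (‖z‖ - 2 * s) ^ 2 / (8 * s) = ‖z‖ ^ 2 / (4 * s) - (1 / (8 * s)) * ‖z‖ ^ 2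
          - ‖z‖ / 2 + s / 2 := by
        field_simp; ring
      linarith
    refine (lintegral_mono e).trans ?_
    rw [lintegral_const_mul' _ _ ENNReal.ofReal_ne_top, lintegral_exp_neg_mul_sq_norm (by positivity),
      ← ENNReal.ofReal_mul (by positivity), ← ENNReal.ofReal_mul (by positivity)]
    apply ENNReal.ofReal_le_ofReal
    have : Real.pi / (1 / (8 * s)) = 2 * (4 * Real.pi * s) := by field_simp; ring
    rw [this, Real.rpow_neg (by positivity), Real.mul_rpow (x := 2) (by norm_num) (by positivity)]
    have : (4 * Real.pi * s) ^ ((n : ℝ) / 2) ≠ 0 := by positivity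
    apply le_of_eq
    field_simp
  refine ne_top_of_le_ne_top ?_ (setLIntegral_mono' measurableSet_Ioi key)
  rw [lintegral_const_mul' _ _ ENNReal.ofReal_ne_top, lintegral_Ioi_exp_neg_mul (by norm_num)]
  exact ENNReal.mul_ne_top ENNReal.ofReal_ne_top ENNReal.ofReal_ne_top

/-- A lower bound for the Bessel kernel, from the heat kernels at times `s ≈ |z|/2`. -/
theorem exists_exp_le_heatMixture {n : ℕ} (hn : 0 < n) :
    ∃ c : ℝ, 0 < c ∧ ∀ z : Space n, ENNReal.ofReal (c * Real.exp (-2 * ‖z‖)) ≤ heatMixture z := by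
  have hpi := Real.pi_pos
  have hn' : (1 : ℝ) ≤ n := by exact_mod_cast hn
  have hN : ∀ r : ℝ, 0 ≤ r → (4 * Real.pi * (r / 2 + 2)) ^ ((n : ℝ) / 2) ≤
      (8 * Real.pi * n) ^ ((n : ℝ) / 2) * Real.exp r := by
    intro r hr
    have h1 : r / 2 + 2 ≤ 2 * n * Real.exp (2 * r / n) := by
      have := Real.add_one_le_exp (2 * r / n)
      calc r / 2 + 2 ≤ 2 * n * (2 * r / n + 1) := by field_simp; nlinarith
        _ ≤ _ := by gcongr
    calc (4 * Real.pi * (r / 2 + 2)) ^ ((n : ℝ) / 2)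
        ≤ (4 * Real.pi * (2 * n * Real.exp (2 * r / n))) ^ ((n : ℝ) / 2) := by gcongr
      _ = (8 * Real.pi * n * Real.exp (2 * r / n)) ^ ((n : ℝ) / 2) := by ring_nf
      _ = _ := by
        rw [Real.mul_rpow (by positivity) (by positivity), ← Real.exp_mul]
        congr 2
        field_simp
  set N : ℝ := (8 * Real.pi * n) ^ ((n : ℝ) / 2) with hNdef
  have hNpos : 0 < N := by positivity
  refine ⟨N⁻¹ * Real.exp (-2), by positivity, fun z => ?_⟩
  set r := ‖z‖ with hr
  have hr0 : 0 ≤ r := norm_nonneg z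
  have hsub : Ioc (r / 2 + 1) (r / 2 + 2) ⊆ Ioi (0 : ℝ) := fun s hs => by
    have := hs.1
    show 0 < s
    linarith
  have hle : ∀ s ∈ Ioc (r / 2 + 1) (r / 2 + 2),
      ENNReal.ofReal (N⁻¹ * Real.exp (-2) * Real.exp (-2 * r)) ≤
        ENNReal.ofReal (heatWeight z s) := by
    intro s hs
    have hs0 : 0 < s := hsub hs
    apply ENNReal.ofReal_le_ofReal
    rw [heatWeight, Real.rpow_neg (by positivity), ← hr]
    have h1 : (4 * Real.pi * s) ^ ((n : ℝ) / 2) ≤ N * Real.exp r := by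
      refine le_trans ?_ (hN r hr0)
      have := hs.2
      gcongr
    have h2 : -(r + 2) ≤ -s - r ^ 2 / (4 * s) := by
      have : r ^ 2 / (4 * s) ≤ r / 2 := by
        rw [div_le_iff₀ (by positivity)]
        nlinarith [hs.1]
      linarith [hs.2]
    calc N⁻¹ * Real.exp (-2) * Real.exp (-2 * r) = (N * Real.exp r)⁻¹ * Real.exp (-(r + 2)) := by
          rw [mul_inv, ← Real.exp_neg, mul_assoc, mul_assoc, ← Real.exp_add, ← Real.exp_add]
          ring_nf
      _ ≤ _ := by gcongr
  calc ENNReal.ofReal (N⁻¹ * Real.exp (-2) * Real.exp (-2 * r))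
      = ∫⁻ _ in Ioc (r / 2 + 1) (r / 2 + 2),
          ENNReal.ofReal (N⁻¹ * Real.exp (-2) * Real.exp (-2 * r)) := by
        rw [setLIntegral_const, Real.volume_Ioc]
        norm_num
    _ ≤ ∫⁻ s in Ioc (r / 2 + 1) (r / 2 + 2), ENNReal.ofReal (heatWeight z s) :=
        setLIntegral_mono' measurableSet_Ioc hle
    _ ≤ _ := lintegral_mono_set hsub

/-! ### The Bessel average of a power times a slowly varying exponential -/

/-- The convex radial function `(|x| - R)₊`, a minorant of the potential up to a factor. -/
def excess {n : ℕ} (R : ℝ) (x : Space n) : ℝ := max (‖x‖ - R) 0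

/-- The smoothed norm `√(M² + |x|²)`, whose second derivatives are at most `1 / M`. -/
def smoothNorm {n : ℕ} (M : ℝ) (x : Space n) : ℝ := √(M ^ 2 + ‖x‖ ^ 2)

/-- The profile `(|x| - R)₊ᵏ exp(-η √(M² + |x|²))` of the lower bounds for the solution. -/
def profile {n : ℕ} (R M η : ℝ) (k : ℕ) (x : Space n) : ℝ :=
  excess R x ^ k * Real.exp (-η * smoothNorm M x)

theorem excess_nonneg {n : ℕ} (R : ℝ) (x : Space n) : 0 ≤ excess R x := le_max_right _ _

theorem profile_nonneg {n : ℕ} (R M η : ℝ) (k : ℕ) (x : Space n) : 0 ≤ profile R M η k x :=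
  mul_nonneg (pow_nonneg (excess_nonneg R x) k) (Real.exp_pos _).le

@[fun_prop]
theorem measurable_excess {n : ℕ} (R : ℝ) : Measurable (excess (n := n) R) := by
  unfold excess; fun_prop

@[fun_prop]
theorem measurable_smoothNorm {n : ℕ} (M : ℝ) : Measurable (smoothNorm (n := n) M) := by
  unfold smoothNorm; fun_prop

@[fun_prop]
theorem measurable_profile {n : ℕ} (R M η : ℝ) (k : ℕ) :
    Measurable (profile (n := n) R M η k) := by
  unfold profile; fun_prop

theorem excess_mul_profile {n : ℕ} (R M η : ℝ) (k : ℕ) (x : Space n) :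
    excess R x * profile R M η k x = profile R M η (k + 1) x := by
  unfold profile; ring

theorem norm_le_smoothNorm {n : ℕ} (M : ℝ) (x : Space n) : ‖x‖ ≤ smoothNorm M x :=
  Real.le_sqrt_of_sq_le (by nlinarith [sq_nonneg M])

theorem smoothNorm_le {n : ℕ} {M : ℝ} (hM : 0 ≤ M) (x : Space n) : smoothNorm M x ≤ M + ‖x‖ := by
  have := norm_nonneg x
  exact Real.sqrt_le_iff.mpr ⟨by positivity, by nlinarith⟩

theorem abs_smoothNorm_sub_le {n : ℕ} (M : ℝ) (x z : Space n) :
    |smoothNorm M (x - z) - smoothNorm M x| ≤ ‖z‖ := by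
  have key : ∀ a b : Space n, smoothNorm M a ≤ smoothNorm M b + ‖a - b‖ := by
    intro a b
    have hb := norm_le_smoothNorm M b
    have h0 := norm_nonneg (a - b)
    have h1 : ‖a‖ ≤ ‖b‖ + ‖a - b‖ := by
      have := norm_add_le b (a - b)
      simpa using this
    have h2 : smoothNorm M b ^ 2 = M ^ 2 + ‖b‖ ^ 2 := Real.sq_sqrt (by positivity)
    have hb0 := norm_nonneg b
    have ha0 := norm_nonneg a
    refine Real.sqrt_le_iff.mpr ⟨by linarith, ?_⟩
    nlinarith
  have h1 := key (x - z) x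
  have h2 := key x (x - z)
  simp only [sub_sub_cancel, sub_sub_cancel_left, norm_neg] at h1 h2
  rw [abs_le]
  constructor <;> linarith

/-- The second difference of the smoothed norm, by concavity of the square root. -/
theorem smoothNorm_sub_add_smoothNorm_add_le {n : ℕ} {M : ℝ} (hM : 0 < M) (x z : Space n) :
    smoothNorm M (x - z) + smoothNorm M (x + z) ≤ 2 * smoothNorm M x + ‖z‖ ^ 2 / M := by
  have h1 : smoothNorm M (x - z) ^ 2 = M ^ 2 + ‖x - z‖ ^ 2 := Real.sq_sqrt (by positivity)
  have h2 : smoothNorm M (x + z) ^ 2 = M ^ 2 + ‖x + z‖ ^ 2 := Real.sq_sqrt (by positivity)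
  have h3 : smoothNorm M x ^ 2 = M ^ 2 + ‖x‖ ^ 2 := Real.sq_sqrt (by positivity)
  have hp := parallelogram_law_with_norm ℝ x z
  have hMx : M ≤ smoothNorm M x := Real.le_sqrt_of_sq_le (by nlinarith [sq_nonneg ‖x‖])
  have hd : 0 ≤ ‖z‖ ^ 2 / M := by positivity
  have hd' : ‖z‖ ^ 2 / M * M = ‖z‖ ^ 2 := by field_simp
  refine abs_le_of_sq_le_sq' ?_ (by linarith) |>.2
  nlinarith [sq_nonneg (smoothNorm M (x - z) - smoothNorm M (x + z))]

theorem exp_le_one_add_add_sq_mul (v : ℝ) : Real.exp v ≤ 1 + v + v ^ 2 * Real.exp |v| := by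
  have h := Complex.norm_exp_sub_sum_le_norm_mul_exp (v : ℂ) 2
  have e : Complex.exp (v : ℂ) - ∑ m ∈ Finset.range 2, (v : ℂ) ^ m / (m.factorial : ℂ) =
      ((Real.exp v - (1 + v) : ℝ) : ℂ) := by
    simp [Finset.sum_range_succ]
  rw [e, Complex.norm_real, Complex.norm_real] at h
  simp only [Real.norm_eq_abs, sq_abs] at h
  linarith [le_abs_self (Real.exp v - (1 + v))]

/-- The second difference of `exp (θ √(M² + |x|²))`. -/
theorem exp_smoothNorm_sub_add_le {n : ℕ} {M θ : ℝ} (hM : 0 < M) (hθ : 0 ≤ θ) (hθ' : θ ≤ 1 / 4)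
    (x z : Space n) :
    Real.exp (θ * smoothNorm M (x - z)) + Real.exp (θ * smoothNorm M (x + z)) ≤
      Real.exp (θ * smoothNorm M x) *
        (2 + 64 * (θ * (1 / M + θ)) * Real.exp (‖z‖ / 2)) := by
  set u := smoothNorm M (x - z) - smoothNorm M x with hu
  set v := smoothNorm M (x + z) - smoothNorm M x with hv
  have hu' : |u| ≤ ‖z‖ := abs_smoothNorm_sub_le M x z
  have hv' : |v| ≤ ‖z‖ := by simpa using abs_smoothNorm_sub_le M x (-z)
  have huv : u + v ≤ ‖z‖ ^ 2 / M := by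
    have := smoothNorm_sub_add_smoothNorm_add_le hM x z
    linarith
  have hz := norm_nonneg z
  have bd : ∀ w : ℝ, |w| ≤ ‖z‖ →
      Real.exp (θ * w) ≤ 1 + θ * w + θ ^ 2 * (‖z‖ ^ 2 * Real.exp (‖z‖ / 4)) := by
    intro w hw
    have h1 := exp_le_one_add_add_sq_mul (θ * w)
    have h2 : |θ * w| ≤ ‖z‖ / 4 := by
      rw [abs_mul, abs_of_nonneg hθ]
      nlinarith [abs_nonneg w]
    have h3 : w ^ 2 ≤ ‖z‖ ^ 2 := by
      rw [← sq_abs w]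
      gcongr
    have : (θ * w) ^ 2 * Real.exp |θ * w| ≤ θ ^ 2 * (‖z‖ ^ 2 * Real.exp (‖z‖ / 4)) := by
      rw [mul_pow, mul_assoc]
      gcongr
    linarith
  have hsq : ‖z‖ ^ 2 ≤ 32 * Real.exp (‖z‖ / 4) := by
    have := Real.quadratic_le_exp_of_nonneg (x := ‖z‖ / 4) (by positivity)
    nlinarith
  have he1 : 1 ≤ Real.exp (‖z‖ / 4) := Real.one_le_exp (by positivity)
  have hsplit : Real.exp (‖z‖ / 2) = Real.exp (‖z‖ / 4) * Real.exp (‖z‖ / 4) := by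
    rw [← Real.exp_add]; ring_nf
  have hA : ‖z‖ ^ 2 * Real.exp (‖z‖ / 4) ≤ 32 * Real.exp (‖z‖ / 2) := by
    rw [hsplit]; nlinarith
  have hB : ‖z‖ ^ 2 ≤ 32 * Real.exp (‖z‖ / 2) := by
    rw [hsplit]; nlinarith
  have hC : θ * (u + v) ≤ θ * (1 / M) * (32 * Real.exp (‖z‖ / 2)) := by
    calc θ * (u + v) ≤ θ * (‖z‖ ^ 2 / M) := by gcongr
      _ = θ * (1 / M) * ‖z‖ ^ 2 := by ring
      _ ≤ _ := by gcongr
  have hD : θ ^ 2 * (‖z‖ ^ 2 * Real.exp (‖z‖ / 4)) ≤ θ ^ 2 * (32 * Real.exp (‖z‖ / 2)) := by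
    gcongr
  have hpos : 0 ≤ θ * (1 / M) * (32 * Real.exp (‖z‖ / 2)) := by positivity
  have key : Real.exp (θ * u) + Real.exp (θ * v) ≤
      2 + 64 * (θ * (1 / M + θ)) * Real.exp (‖z‖ / 2) := by
    have h1 := bd u hu'
    have h2 := bd v hv'
    nlinarith
  have e1 : Real.exp (θ * smoothNorm M (x - z)) =
      Real.exp (θ * smoothNorm M x) * Real.exp (θ * u) := by
    rw [← Real.exp_add, hu]; ring_nf
  have e2 : Real.exp (θ * smoothNorm M (x + z)) =
      Real.exp (θ * smoothNorm M x) * Real.exp (θ * v) := by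
    rw [← Real.exp_add, hv]; ring_nf
  rw [e1, e2, ← mul_add]
  gcongr

/-- Averages over the Bessel measure may be symmetrized, as the measure is even. -/
theorem two_mul_lintegral_besselMeasure {n : ℕ} (g : Space n → ENNReal) (hg : Measurable g)
    (x : Space n) :
    2 * ∫⁻ z, g (x - z) ∂besselMeasure n =
      ∫⁻ z, (g (x - z) + g (x + z)) ∂besselMeasure n := by
  have h1 : Measurable fun z : Space n => g (x - z) := hg.comp (by fun_prop)
  rw [lintegral_add_left h1, two_mul]
  congr 1
  rw [← lintegral_besselMeasure_neg (fun z => g (x - z)) h1]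
  simp

theorem exists_lintegral_exp_smoothNorm_le (n : ℕ) :
    ∃ C : ℝ, 0 < C ∧ ∀ M θ : ℝ, 0 < M → 0 ≤ θ → θ ≤ 1 / 4 → ∀ x : Space n,
      ∫⁻ z, ENNReal.ofReal (Real.exp (θ * smoothNorm M (x - z))) ∂besselMeasure n ≤
        ENNReal.ofReal (Real.exp (θ * smoothNorm M x) * (1 + C * (θ * (1 / M + θ)))) := by
  set D := ∫⁻ z, ENNReal.ofReal (Real.exp (‖z‖ / 2)) ∂besselMeasure n with hD
  have hDtop : D ≠ ⊤ := lintegral_exp_norm_besselMeasure_ne_top n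
  refine ⟨32 * (D.toReal + 1), by positivity, fun M θ hM hθ hθ' x => ?_⟩
  have h2 := two_mul_lintegral_besselMeasure
    (fun y : Space n => ENNReal.ofReal (Real.exp (θ * smoothNorm M y))) (by fun_prop) x
  have h3 : ∫⁻ z, (ENNReal.ofReal (Real.exp (θ * smoothNorm M (x - z))) +
      ENNReal.ofReal (Real.exp (θ * smoothNorm M (x + z)))) ∂besselMeasure n ≤
      ENNReal.ofReal (2 * (Real.exp (θ * smoothNorm M x) *
        (1 + 32 * (D.toReal + 1) * (θ * (1 / M + θ))))) := by
    calc _ ≤ ∫⁻ z, (ENNReal.ofReal (Real.exp (θ * smoothNorm M x) * 2) +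
          ENNReal.ofReal (Real.exp (θ * smoothNorm M x) * (64 * (θ * (1 / M + θ)))) *
            ENNReal.ofReal (Real.exp (‖z‖ / 2))) ∂besselMeasure n := by
          refine lintegral_mono fun z => ?_
          rw [← ENNReal.ofReal_add (by positivity) (by positivity),
            ← ENNReal.ofReal_mul (by positivity), ← ENNReal.ofReal_add (by positivity)
              (by positivity)]
          apply ENNReal.ofReal_le_ofReal
          refine (exp_smoothNorm_sub_add_le hM hθ hθ' x z).trans (le_of_eq ?_)
          ring
      _ = ENNReal.ofReal (Real.exp (θ * smoothNorm M x) * 2) +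
          ENNReal.ofReal (Real.exp (θ * smoothNorm M x) * (64 * (θ * (1 / M + θ)))) *
            ENNReal.ofReal D.toReal := by
          rw [lintegral_add_left measurable_const, lintegral_const, measure_univ, mul_one,
            lintegral_const_mul' _ _ ENNReal.ofReal_ne_top, ENNReal.ofReal_toReal hDtop]
      _ ≤ _ := by
          rw [← ENNReal.ofReal_mul (by positivity), ← ENNReal.ofReal_add (by positivity)
              (by positivity)]
          apply ENNReal.ofReal_le_ofReal
          have : 0 ≤ Real.exp (θ * smoothNorm M x) * (64 * (θ * (1 / M + θ))) := by positivity
          nlinarith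
  rw [← h2, ENNReal.ofReal_mul (by norm_num), ENNReal.ofReal_ofNat] at h3
  exact (ENNReal.mul_le_mul_iff_right (by norm_num) (by norm_num)).mp h3

/-- The mean value inequality for the convex function `(|x| - R)₊`. -/
theorem excess_le_lintegral {n : ℕ} (R : ℝ) (x : Space n) :
    ENNReal.ofReal (excess R x) ≤
      ∫⁻ z, ENNReal.ofReal (excess R (x - z)) ∂besselMeasure n := by
  have h2 := two_mul_lintegral_besselMeasure
    (fun y : Space n => ENNReal.ofReal (excess R y)) (by fun_prop) x
  have h3 : 2 * ENNReal.ofReal (excess R x) ≤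
      ∫⁻ z, (ENNReal.ofReal (excess R (x - z)) + ENNReal.ofReal (excess R (x + z)))
        ∂besselMeasure n := by
    calc 2 * ENNReal.ofReal (excess R x) =
        ∫⁻ _, 2 * ENNReal.ofReal (excess R x) ∂besselMeasure n := by simp
      _ ≤ _ := by
        refine lintegral_mono fun z => ?_
        rw [two_mul, ← ENNReal.ofReal_add (excess_nonneg _ _) (excess_nonneg _ _),
          ← ENNReal.ofReal_add (excess_nonneg _ _) (excess_nonneg _ _)]
        apply ENNReal.ofReal_le_ofReal
        have h : 2 * ‖x‖ ≤ ‖x - z‖ + ‖x + z‖ := by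
          have := norm_add_le (x - z) (x + z)
          have e : x - z + (x + z) = (2 : ℝ) • x := by rw [two_smul]; abel
          rwa [e, norm_smul, Real.norm_ofNat] at this
        unfold excess
        have a1 := le_max_left (‖x - z‖ - R) 0
        have a2 := le_max_left (‖x + z‖ - R) 0
        have a3 := le_max_right (‖x - z‖ - R) 0
        have a4 := le_max_right (‖x + z‖ - R) 0
        rcases max_choice (‖x‖ - R) 0 with h | h <;> rw [h] <;> linarith
  rw [← h2] at h3
  exact (ENNReal.mul_le_mul_iff_right (by norm_num) (by norm_num)).mp h3

/-- The tangent inequality at `(a₀, b₀)` for the convex function `(a, b) ↦ a (a / b)ᵖ` on the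
quadrant, with `r = a₀ / b₀`. -/
theorem tangent_le_mul_div_pow {a b r : ℝ} (ha : 0 ≤ a) (hb : 0 < b) (hr : 0 ≤ r) {p : ℕ}
    (hp : 1 ≤ p) :
    (p + 1) * r ^ p * a ≤ a * (a / b) ^ p + p * r ^ (p + 1) * b := by
  rcases hr.eq_or_lt with rfl | hr
  · have : (0 : ℝ) ^ p = 0 := zero_pow (by omega)
    rw [this, pow_succ, this]
    simp
    positivity
  · have h := one_add_mul_le_pow (a := a / b / r - 1) (by
      have : 0 ≤ a / b / r := by positivity
      linarith) (p + 1)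
    have h2 := mul_le_mul_of_nonneg_left h (show 0 ≤ r ^ (p + 1) * b by positivity)
    have e1 : r ^ (p + 1) * b * (1 + (a / b / r - 1)) ^ (p + 1) = a * (a / b) ^ p := by
      rw [add_sub_cancel, div_pow (a / b), pow_succ (a / b)]
      field_simp
    have e2 : r ^ (p + 1) * b * (1 + ((p + 1 : ℕ) : ℝ) * (a / b / r - 1)) =
        (p + 1) * r ^ p * a - p * r ^ (p + 1) * b := by
      push_cast
      rw [pow_succ r]
      field_simp
      ring
    rw [e1, e2] at h2
    linarith

/-- The convexity inequality that drives the iteration. A profile `aᵖ⁺¹ b⁻ᵖ`, with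
`a = (|x| - R)₊` and `b = exp ((η / p) √(M² + |x|²))`, is a jointly convex function of `(a, b)`;
averaging does not decrease `a`, and it increases `b` by a factor close to one only. -/
theorem exists_profile_le_lintegral (n : ℕ) :
    ∃ C : ℝ, 0 < C ∧ ∀ (R M η : ℝ) (p : ℕ), 0 < M → 0 ≤ η → 1 ≤ p → η / p ≤ 1 / 4 →
      ∀ x : Space n,
        ENNReal.ofReal (Real.exp (-(C * η * (1 / M + η / p))) * profile R M η (p + 1) x) ≤
          ∫⁻ z, ENNReal.ofReal (profile R M η (p + 1) (x - z)) ∂besselMeasure n := by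
  obtain ⟨C, hC, hexp⟩ := exists_lintegral_exp_smoothNorm_le n
  refine ⟨C, hC, fun R M η p hM hη hp hηp x => ?_⟩
  have hp0 : (0 : ℝ) < p := by exact_mod_cast hp
  set θ := η / p with hθdef
  have hθ : 0 ≤ θ := by positivity
  have hθp : p * θ = η := by rw [hθdef]; field_simp
  set a : Space n → ℝ := excess R with ha
  set b : Space n → ℝ := fun y => Real.exp (θ * smoothNorm M y) with hb
  set b₀ : ℝ := b x * (1 + C * (θ * (1 / M + θ))) with hb₀
  have hb₀pos : 0 < b₀ := by positivity
  set r : ℝ := a x / b₀ with hr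
  have hr0 : 0 ≤ r := div_nonneg (excess_nonneg _ _) hb₀pos.le
  have hprof : ∀ y : Space n, profile R M η (p + 1) y = a y * (a y / b y) ^ p := by
    intro y
    rw [profile, div_pow, hb, ← Real.exp_nat_mul, ← mul_assoc, hθp, neg_mul, Real.exp_neg,
      pow_succ]
    field_simp
    exact mul_comm _ _
  have hmeas : Measurable fun y : Space n => ENNReal.ofReal (profile R M η (p + 1) y) := by fun_prop
  have hmeasI : Measurable fun z : Space n => ENNReal.ofReal (profile R M η (p + 1) (x - z)) :=
    hmeas.comp (by fun_prop)
  set I := ∫⁻ z, ENNReal.ofReal (profile R M η (p + 1) (x - z)) ∂besselMeasure n with hI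
  have h1 : ENNReal.ofReal ((p + 1) * r ^ p) *
      ∫⁻ z, ENNReal.ofReal (a (x - z)) ∂besselMeasure n ≤
      I + ENNReal.ofReal (p * r ^ (p + 1)) *
        ∫⁻ z, ENNReal.ofReal (b (x - z)) ∂besselMeasure n := by
    rw [← lintegral_const_mul' _ _ ENNReal.ofReal_ne_top,
      ← lintegral_const_mul' _ _ ENNReal.ofReal_ne_top, hI, ← lintegral_add_left hmeasI]
    refine lintegral_mono fun z => ?_
    have hbz : 0 < b (x - z) := Real.exp_pos _
    rw [← ENNReal.ofReal_mul (by positivity), ← ENNReal.ofReal_mul (by positivity),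
      ← ENNReal.ofReal_add (profile_nonneg _ _ _ _ _) (by positivity), hprof]
    exact ENNReal.ofReal_le_ofReal (tangent_le_mul_div_pow (excess_nonneg _ _) hbz hr0 hp)
  have h2 : ENNReal.ofReal ((p + 1) * r ^ p) * ENNReal.ofReal (a x) ≤
      I + ENNReal.ofReal (p * r ^ (p + 1)) * ENNReal.ofReal b₀ :=
    (mul_le_mul_right (excess_le_lintegral R x) _).trans <| h1.trans <|
      add_le_add le_rfl (mul_le_mul_right (hexp M θ hM hθ hηp x) _)
  have hax : a x = r * b₀ := by rw [hr]; field_simp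
  have h3 : ENNReal.ofReal (r ^ (p + 1) * b₀) ≤ I := by
    have hfin : ENNReal.ofReal (p * r ^ (p + 1) * b₀) ≠ ⊤ := ENNReal.ofReal_ne_top
    rw [← ENNReal.ofReal_mul (by positivity), ← ENNReal.ofReal_mul (by positivity)] at h2
    have e : (p + 1) * r ^ p * a x = r ^ (p + 1) * b₀ + p * r ^ (p + 1) * b₀ := by
      rw [hax]; ring
    rw [e, ENNReal.ofReal_add (by positivity) (by positivity)] at h2
    exact (ENNReal.add_le_add_iff_right hfin).mp h2
  refine le_trans (ENNReal.ofReal_le_ofReal ?_) h3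
  have e4 : r ^ (p + 1) * b₀ = a x * (a x / b x) ^ p * ((1 + C * (θ * (1 / M + θ))) ^ p)⁻¹ := by
    rw [pow_succ, mul_assoc, ← hax, hr, hb₀, ← div_div, div_pow (a x / b x)]
    ring
  rw [e4, ← hprof, mul_comm]
  refine mul_le_mul_of_nonneg_left ?_ (profile_nonneg _ _ _ _ _)
  rw [Real.exp_neg]
  gcongr
  calc (1 + C * (θ * (1 / M + θ))) ^ p ≤ Real.exp (C * (θ * (1 / M + θ))) ^ p := by
        gcongr
        rw [add_comm]
        exact Real.add_one_le_exp _
    _ = Real.exp (C * η * (1 / M + θ)) := by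
        rw [← Real.exp_nat_mul, ← hθp]
        ring_nf

/-! ### Lower bounds for supersolutions -/

/-- A `[0, ∞]`-valued supersolution on `[0, b]` of the integral equation for `m = eᵗ u`:
`m(t) ≥ u₀ + ∫₀ᵗ 𝓑((a + 1) m)` almost everywhere, for each `t ∈ [0, b]`. -/
def IsSupersolution {n : ℕ} (a : Space n → ℝ → ℝ) (u₀ : Space n → ℝ) (b : ℝ)
    (m : ℝ → Space n → ENNReal) : Prop :=
  ∀ t ∈ Icc 0 b, ∀ᵐ x : Space n,
    ENNReal.ofReal (u₀ x) + ∫⁻ τ in Ioo 0 t, ∫⁻ y : Space n,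
      ENNReal.ofReal (besselKernel (x - y) * (a y τ + 1)) * m τ y ≤ m t x

/-- The `j`-th Picard iterate of a profile bounds a supersolution from below. -/
theorem IsSupersolution.profile_le {n : ℕ} (hn : 0 < n) {a : Space n → ℝ → ℝ}
    {u₀ : Space n → ℝ} {b : ℝ} {m : ℝ → Space n → ENNReal} (hm : IsSupersolution a u₀ b m)
    {f : ℝ → ℝ} (hf : IntervalIntegrable f volume 0 b) (hf0 : ∀ τ ∈ Ioc 0 b, 0 ≤ f τ)
    {R : ℝ} (hfa : ∀ τ ∈ Ioc 0 b, ∀ y : Space n, f τ * excess R y ≤ a y τ + 1)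
    {M η c l : ℝ} {k : ℕ} (hc : 0 ≤ c) (hl : 0 ≤ l)
    (hstart : ∀ᵐ x : Space n, c * profile R M η k x ≤ u₀ x)
    (hstep : ∀ (j : ℕ) (x : Space n), ENNReal.ofReal (l * profile R M η (k + j + 1) x) ≤
      ∫⁻ z, ENNReal.ofReal (profile R M η (k + j + 1) (x - z)) ∂besselMeasure n) (j : ℕ) :
    ∀ t ∈ Icc 0 b, ∀ᵐ x : Space n,
      ENNReal.ofReal (c * l ^ j * ((∫ s in (0 : ℝ)..t, f s) ^ j / j.factorial) *
        profile R M η (k + j) x) ≤ m t x := by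
  induction j with
  | zero =>
    intro t ht
    filter_upwards [hm t ht, hstart] with x hx hx'
    simp only [pow_zero, Nat.factorial_zero, Nat.cast_one, div_one, mul_one, add_zero]
    exact (ENNReal.ofReal_le_ofReal hx').trans (le_self_add.trans hx)
  | succ j ih =>
    intro t ht
    filter_upwards [hm t ht] with x hx
    set F : ℝ → ℝ := fun t => ∫ s in (0 : ℝ)..t, f s with hF
    set d : ℝ := c * l ^ j / j.factorial with hd
    have hd0 : 0 ≤ d := by positivity
    have hft : IntervalIntegrable f volume 0 t :=
      hf.mono_set (by rw [uIcc_of_le ht.1, uIcc_of_le (ht.1.trans ht.2)]; exact Icc_subset_Icc_right ht.2)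
    have hF0 : ∀ τ ∈ Ioc 0 t, 0 ≤ F τ := fun τ hτ =>
      intervalIntegral.integral_nonneg_of_ae_restrict hτ.1.le <| by
        rw [← restrict_Ioc_eq_restrict_Icc]
        filter_upwards [ae_restrict_mem measurableSet_Ioc] with s hs
        exact hf0 s ⟨hs.1, hs.2.trans (hτ.2.trans ht.2)⟩
    set g : ℝ → ℝ := fun τ => d * (f τ * F τ ^ j) with hg
    have hg0 : ∀ τ ∈ Ioc 0 t, 0 ≤ g τ := fun τ hτ => by
      have := hf0 τ ⟨hτ.1, hτ.2.trans ht.2⟩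
      have := hF0 τ hτ
      positivity
    have hFc : ContinuousOn (fun τ => F τ ^ j) (uIcc 0 t) :=
      (intervalIntegral.continuousOn_primitive_interval' hft left_mem_uIcc).pow j
    have hgi : IntervalIntegrable g volume 0 t := (hft.mul_continuousOn hFc).const_mul d
    have hgint : ∫⁻ τ in Ioo 0 t, ENNReal.ofReal (g τ) =
        ENNReal.ofReal (d * (F t ^ (j + 1) / (j + 1))) := by
      rw [restrict_Ioo_eq_restrict_Ioc, ← intervalIntegral_mul_primitive_pow hft j,
        ← intervalIntegral.integral_const_mul, intervalIntegral.integral_of_le ht.1,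
        ofReal_integral_eq_lintegral_ofReal]
      · exact hgi.1
      · filter_upwards [ae_restrict_mem measurableSet_Ioc] with s hs using hg0 s hs
    have hinner : ∀ τ ∈ Ioo 0 t,
        ENNReal.ofReal (g τ) * ENNReal.ofReal (l * profile R M η (k + j + 1) x) ≤
          ∫⁻ y, ENNReal.ofReal (besselKernel (x - y) * (a y τ + 1)) * m τ y := by
      intro τ hτ
      have hτb : τ ∈ Ioc 0 b := ⟨hτ.1, hτ.2.le.trans ht.2⟩
      have hgτ := hg0 τ ⟨hτ.1, hτ.2.le⟩
      calc _ ≤ ENNReal.ofReal (g τ) *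
            ∫⁻ z, ENNReal.ofReal (profile R M η (k + j + 1) (x - z)) ∂besselMeasure n :=
            mul_le_mul_right (hstep j x) _
        _ = ∫⁻ y, ENNReal.ofReal (g τ) * (ENNReal.ofReal (besselKernel (x - y)) *
              ENNReal.ofReal (profile R M η (k + j + 1) y)) := by
            rw [← lintegral_besselKernel_mul hn x
              (fun y => ENNReal.ofReal (profile R M η (k + j + 1) y)) (by fun_prop),
              lintegral_const_mul' _ _ ENNReal.ofReal_ne_top]
        _ ≤ _ := by
            refine lintegral_mono_ae ?_
            filter_upwards [ih τ ⟨hτ.1.le, hτb.2⟩] with y hy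
            have hB := besselKernel_nonneg (x - y)
            have hq := excess_nonneg R y
            have hfτ := hf0 τ hτb
            have hFτ := hF0 τ ⟨hτ.1, hτ.2.le⟩
            have hp := profile_nonneg R M η (k + j) y
            have hp' := profile_nonneg R M η (k + j + 1) y
            calc _ = ENNReal.ofReal (besselKernel (x - y) * (f τ * excess R y)) *
                  ENNReal.ofReal (c * l ^ j * (F τ ^ j / j.factorial) *
                    profile R M η (k + j) y) := by
                  rw [← ENNReal.ofReal_mul hB, ← ENNReal.ofReal_mul hgτ,
                    ← ENNReal.ofReal_mul (by positivity), ← excess_mul_profile]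
                  congr 1
                  simp only [hg, hd]
                  ring
              _ ≤ _ := by
                  gcongr
                  exact hfa τ hτb y
    have hl' := profile_nonneg R M η (k + j + 1) x
    calc _ = ENNReal.ofReal (d * (F t ^ (j + 1) / (j + 1))) *
          ENNReal.ofReal (l * profile R M η (k + j + 1) x) := by
          rw [← ENNReal.ofReal_mul' (by positivity), ← add_assoc k j 1, Nat.factorial_succ]
          congr 1
          simp only [hd, hF]
          push_cast
          rw [pow_succ l]
          field_simp
      _ = ∫⁻ τ in Ioo 0 t,
          ENNReal.ofReal (g τ) * ENNReal.ofReal (l * profile R M η (k + j + 1) x) := by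
          rw [lintegral_mul_const' _ _ ENNReal.ofReal_ne_top, hgint]
      _ ≤ ∫⁻ τ in Ioo 0 t, ∫⁻ y,
          ENNReal.ofReal (besselKernel (x - y) * (a y τ + 1)) * m τ y :=
          setLIntegral_mono' measurableSet_Ioo hinner
      _ ≤ _ := le_add_self.trans hx

theorem integral_Ioi_sub_pow_mul_exp {β : ℝ} (hβ : 0 < β) (R : ℝ) (k : ℕ) :
    ∫ r in Ioi R, (r - R) ^ k * Real.exp (-β * r) =
      Real.exp (-β * R) * (k.factorial / β ^ (k + 1)) := by
  have h := Real.integral_rpow_mul_exp_neg_mul_Ioi (a := k + 1) (r := β) (by positivity) hβ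
  have hmp := measurePreserving_sub_right (volume : Measure ℝ) R
  have h2 := hmp.setIntegral_preimage_emb
    (measurableEmbedding_subRight R) (fun s => s ^ k * Real.exp (-(β * s))) (Ioi 0)
  have hpre : (fun r : ℝ => r - R) ⁻¹' Ioi 0 = Ioi R := by
    ext r; simp
  rw [hpre] at h2
  have h3 : ∫ s in Ioi (0 : ℝ), s ^ k * Real.exp (-(β * s)) = k.factorial / β ^ (k + 1) := by
    have e : (k : ℝ) + 1 = ((k + 1 : ℕ) : ℝ) := by push_cast; ring
    rw [Real.Gamma_nat_eq_factorial, e, Real.rpow_natCast, ← e] at h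
    simp only [add_sub_cancel_right, Real.rpow_natCast] at h
    rw [h, div_pow, one_pow]
    ring
  rw [← h3, ← h2, ← integral_const_mul]
  refine integral_congr_ae (ae_of_all _ fun r => ?_)
  have : Real.exp (-β * r) = Real.exp (-β * R) * Real.exp (-(β * (r - R))) := by
    rw [← Real.exp_add]; ring_nf
  simp only [this]
  ring

/-- The exponential integrals of the profiles, computed in polar coordinates, grow like those of
`|x|ᵏ exp (-(κ + η) |x|)`. -/
theorem exists_le_lintegral_exp_mul_profile {n : ℕ} (hn : 0 < n) {R M η κ : ℝ} (hR : 0 < R)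
    (hM : 0 ≤ M) (hη : 0 ≤ η) (hκ : 0 < κ) :
    ∃ c : ℝ, 0 < c ∧ ∀ k : ℕ, ENNReal.ofReal (c * (k.factorial / (κ + η) ^ k)) ≤
      ∫⁻ x : Space n, ENNReal.ofReal (Real.exp (-κ * ‖x‖) * profile R M η k x) := by
  have : Nonempty (Fin n) := ⟨⟨0, hn⟩⟩
  set β := κ + η with hβdef
  have hβ : 0 < β := by positivity
  set V : ℝ := (volume : Measure (Space n)).real (Metric.ball 0 1) with hV
  have hVpos : 0 < V := by
    rw [hV, Measure.real, ENNReal.toReal_pos_iff]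
    exact ⟨Metric.measure_ball_pos _ _ one_pos, measure_ball_lt_top⟩
  have hn' : (0 : ℝ) < n := by exact_mod_cast hn
  refine ⟨Real.exp (-η * M) * (n * (V * (R ^ (n - 1) * (Real.exp (-β * R) / β)))), by positivity,
    fun k => ?_⟩
  set f : ℝ → ℝ := fun r => max (r - R) 0 ^ k * Real.exp (-β * r) with hf
  have hf0 : ∀ r, 0 ≤ f r := fun r => by
    have := le_max_right (r - R) 0
    positivity
  have hint : IntegrableOn (fun r : ℝ => r ^ (n - 1) * f r) (Ioi 0) := by
    have h := integrableOn_rpow_mul_exp_neg_mul_rpow (p := 1) (s := ((n - 1 + k : ℕ) : ℝ)) (b := β)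
      (by have : (0 : ℝ) ≤ ((n - 1 + k : ℕ) : ℝ) := by positivity
          linarith) one_pos hβ
    refine h.mono' (by fun_prop) ?_
    filter_upwards [ae_restrict_mem measurableSet_Ioi] with r hr
    have hr : 0 < r := hr
    have h0 := hf0 r
    rw [Real.norm_of_nonneg (by positivity), Real.rpow_natCast, Real.rpow_one, pow_add, mul_assoc]
    have : max (r - R) 0 ≤ r := max_le (by linarith) hr.le
    have h3 := le_max_right (r - R) 0
    simp only [hf]
    gcongr
  have hpolar := integral_fun_norm_addHaar (volume : Measure (Space n)) f
  rw [finrank_euclideanSpace_fin] at hpolar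
  have hlow : R ^ (n - 1) * (Real.exp (-β * R) * (k.factorial / β ^ (k + 1))) ≤
      ∫ r in Ioi (0 : ℝ), r ^ (n - 1) * f r := by
    rw [← integral_Ioi_sub_pow_mul_exp hβ R k, ← integral_const_mul]
    have hsub : Ioi R ⊆ Ioi (0 : ℝ) := Ioi_subset_Ioi hR.le
    calc _ ≤ ∫ r in Ioi R, r ^ (n - 1) * f r := by
          have hle : ∀ r ∈ Ioi R, R ^ (n - 1) * ((r - R) ^ k * Real.exp (-β * r)) ≤
              r ^ (n - 1) * f r := by
            intro r hr
            have hr : R < r := hr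
            have : 0 ≤ r - R := by linarith
            simp only [hf, max_eq_left this]
            gcongr
          refine integral_mono_of_nonneg ?_ (hint.mono_set hsub) ?_
          · filter_upwards [ae_restrict_mem measurableSet_Ioi] with r hr
            have hr : R < r := hr
            have : 0 ≤ r - R := by linarith
            show 0 ≤ R ^ (n - 1) * ((r - R) ^ k * Real.exp (-β * r))
            positivity
          · filter_upwards [ae_restrict_mem measurableSet_Ioi] with r hr using hle r hr
      _ ≤ _ := by
          refine setIntegral_mono_set hint ?_ hsub.eventuallyLE
          filter_upwards [ae_restrict_mem measurableSet_Ioi] with r hr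
          have hr : 0 < r := hr
          have := hf0 r
          show 0 ≤ r ^ (n - 1) * f r
          positivity
  have hfint : Integrable (fun x : Space n => f ‖x‖) := by
    rw [integrable_fun_norm_addHaar, finrank_euclideanSpace_fin]
    simpa only [smul_eq_mul] using hint
  calc _ ≤ ENNReal.ofReal (Real.exp (-η * M) * ∫ x : Space n, f ‖x‖) := by
        apply ENNReal.ofReal_le_ofReal
        simp only [smul_eq_mul] at hpolar
        rw [hpolar, nsmul_eq_mul, ← hV]
        calc _ = Real.exp (-η * M) * (n * (V * (R ^ (n - 1) *
              (Real.exp (-β * R) * (k.factorial / β ^ (k + 1)))))) := by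
              rw [pow_succ]
              field_simp
          _ ≤ _ := by gcongr
    _ = ∫⁻ x : Space n, ENNReal.ofReal (Real.exp (-η * M)) * ENNReal.ofReal (f ‖x‖) := by
        rw [ENNReal.ofReal_mul (by positivity),
          ofReal_integral_eq_lintegral_ofReal hfint (ae_of_all _ fun x => hf0 _),
          lintegral_const_mul' _ _ ENNReal.ofReal_ne_top]
    _ ≤ _ := by
        refine lintegral_mono fun x => ?_
        rw [← ENNReal.ofReal_mul (by positivity)]
        apply ENNReal.ofReal_le_ofReal
        simp only [hf, profile]
        have h3 := pow_nonneg (excess_nonneg R x) k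
        have h4 : Real.exp (-η * M) * Real.exp (-β * ‖x‖) ≤
            Real.exp (-κ * ‖x‖) * Real.exp (-η * smoothNorm M x) := by
          rw [← Real.exp_add, ← Real.exp_add]
          apply Real.exp_le_exp.mpr
          have := mul_le_mul_of_nonneg_left (smoothNorm_le hM x) hη
          rw [hβdef]
          nlinarith
        calc _ = excess R x ^ k * (Real.exp (-η * M) * Real.exp (-β * ‖x‖)) := by
              unfold excess; ring
          _ ≤ excess R x ^ k * (Real.exp (-κ * ‖x‖) * Real.exp (-η * smoothNorm M x)) := by
              gcongr
          _ = _ := by ring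

/-- If `u₀` decays at most like `exp (-η |x|)` and `∫₀ᵇ f > κ + η`, where `f(t) (|x| - R)₊` is a
minorant of `a + 1`, then no supersolution has a finite integral against `exp (-κ |x|)` at
time `b`. -/
theorem IsSupersolution.lintegral_exp_eq_top {n : ℕ} (hn : 0 < n) {a : Space n → ℝ → ℝ}
    {u₀ : Space n → ℝ} {b : ℝ} (hb : 0 ≤ b) {m : ℝ → Space n → ENNReal}
    (hm : IsSupersolution a u₀ b m)
    {f : ℝ → ℝ} (hf : IntervalIntegrable f volume 0 b) (hf0 : ∀ τ ∈ Ioc 0 b, 0 ≤ f τ)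
    {R : ℝ} (hR : 0 < R) (hfa : ∀ τ ∈ Ioc 0 b, ∀ y : Space n, f τ * excess R y ≤ a y τ + 1)
    {η κ : ℝ} (hη : 0 ≤ η) (hκ : 0 < κ) (hpos : ∀ᵐ x, 0 < u₀ x)
    (hu₀ : ∀ᵐ x : Space n, R ≤ ‖x‖ → Real.exp (-η * ‖x‖) ≤ u₀ x)
    (hlarge : κ + η < ∫ s in (0 : ℝ)..b, f s) :
    ∫⁻ x, ENNReal.ofReal (Real.exp (-κ * ‖x‖)) * m b x = ⊤ := by
  obtain ⟨C, hC, hker⟩ := exists_profile_le_lintegral n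
  set F := ∫ s in (0 : ℝ)..b, f s with hF
  -- a slightly larger decay rate `ω` leaves room for the polynomial factor of the first profile
  set ω := (η + (F - κ)) / 2 with hω
  have hω1 : η < ω := by rw [hω]; linarith
  have hω2 : κ + ω < F := by rw [hω]; linarith
  have hω0 : 0 < ω := by linarith
  set β := κ + ω with hβ
  have hβ0 : 0 < β := by positivity
  set ε := Real.log (F / β) / 2 with hε
  have hratio : 1 < F / β := (one_lt_div hβ0).mpr hω2
  have hε0 : 0 < ε := half_pos (Real.log_pos hratio)
  set l := Real.exp (-ε) with hl
  have hl0 : 0 < l := Real.exp_pos _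
  have hgrow : 1 < l * F / β := by
    have : l * F / β = Real.exp ε := by
      rw [mul_div_assoc, ← Real.exp_log (show 0 < F / β by positivity), hl, ← Real.exp_add, hε]
      ring_nf
    rw [this]
    exact Real.one_lt_exp_iff.mpr hε0
  set M := 2 * C * ω / ε with hM
  have hM0 : 0 < M := by positivity
  obtain ⟨k, hk⟩ := exists_nat_ge (max 1 (max (4 * ω) (2 * C * ω ^ 2 / ε)))
  have hk1 : (1 : ℝ) ≤ k := (le_max_left _ _).trans hk
  have hk2 : 4 * ω ≤ k := (le_max_left _ _).trans ((le_max_right _ _).trans hk)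
  have hk3 : 2 * C * ω ^ 2 / ε ≤ k := (le_max_right _ _).trans ((le_max_right _ _).trans hk)
  have hk1' : 1 ≤ k := by exact_mod_cast hk1
  have hstep : ∀ (j : ℕ) (x : Space n), ENNReal.ofReal (l * profile R M ω (k + j + 1) x) ≤
      ∫⁻ z, ENNReal.ofReal (profile R M ω (k + j + 1) (x - z)) ∂besselMeasure n := by
    intro j x
    have hkj : (k : ℝ) ≤ ((k + j : ℕ) : ℝ) := by exact_mod_cast Nat.le_add_right k j
    have hkj0 : (0 : ℝ) < ((k + j : ℕ) : ℝ) := by linarith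
    refine le_trans (ENNReal.ofReal_le_ofReal ?_)
      (hker R M ω (k + j) hM0 hω0.le (by omega) ?_ x)
    · refine mul_le_mul_of_nonneg_right (Real.exp_le_exp.mpr ?_) (profile_nonneg _ _ _ _ _)
      have h1 : C * ω * (1 / M) = ε / 2 := by rw [hM]; field_simp
      have h2 : C * ω * (ω / ((k + j : ℕ) : ℝ)) ≤ ε / 2 := by
        have : 2 * C * ω ^ 2 / ε ≤ ((k + j : ℕ) : ℝ) := hk3.trans hkj
        rw [div_le_iff₀ hε0] at this
        rw [← mul_div_assoc, div_le_iff₀ hkj0]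
        nlinarith
      rw [mul_add]
      linarith
    · rw [div_le_iff₀ hkj0]
      linarith
  set d := ω - η with hd
  have hd0 : 0 < d := by rw [hd]; linarith
  set c := d ^ k / k.factorial with hc
  have hc0 : 0 < c := by positivity
  have hstart : ∀ᵐ x : Space n, c * profile R M ω k x ≤ u₀ x := by
    filter_upwards [hpos, hu₀] with x hx0 hx
    by_cases hxR : R ≤ ‖x‖
    · refine le_trans ?_ (hx hxR)
      have hn0 := norm_nonneg x
      have hq : excess R x ≤ ‖x‖ := max_le (by linarith) hn0
      have hq0 := excess_nonneg R x
      calc c * profile R M ω k x ≤ c * (‖x‖ ^ k * Real.exp (-ω * ‖x‖)) := by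
            unfold profile
            have := mul_le_mul_of_nonneg_left (norm_le_smoothNorm M x) hω0.le
            have h' : -ω * smoothNorm M x ≤ -ω * ‖x‖ := by linarith
            gcongr
        _ = (d * ‖x‖) ^ k / k.factorial * Real.exp (-ω * ‖x‖) := by
            rw [hc, mul_pow]; ring
        _ ≤ Real.exp (d * ‖x‖) * Real.exp (-ω * ‖x‖) := by
            gcongr
            exact Real.pow_div_factorial_le_exp _ (by positivity) k
        _ = Real.exp (-η * ‖x‖) := by
            rw [← Real.exp_add, hd]; ring_nf
    · have : excess R x = 0 := max_eq_right (by linarith)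
      rw [profile, this, zero_pow (by omega)]
      simpa using hx0.le
  obtain ⟨c', hc'0, hc'⟩ := exists_le_lintegral_exp_mul_profile hn hR hM0.le hω0.le hκ
  have hF0 : 0 < F := by linarith
  have hlow : ∀ j : ℕ, ENNReal.ofReal (c * c' / β ^ k * (l * F / β) ^ j) ≤
      ∫⁻ x, ENNReal.ofReal (Real.exp (-κ * ‖x‖)) * m b x := by
    intro j
    have hj := hm.profile_le hn hf hf0 hfa hc0.le hl0.le hstart hstep j b ⟨hb, le_rfl⟩
    calc _ ≤ ENNReal.ofReal (c * l ^ j * (F ^ j / j.factorial)) *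
          ENNReal.ofReal (c' * ((k + j).factorial / β ^ (k + j))) := by
          rw [← ENNReal.ofReal_mul (by positivity)]
          apply ENNReal.ofReal_le_ofReal
          have hfac : (1 : ℝ) ≤ (k + j).factorial / j.factorial := by
            rw [one_le_div (by positivity)]
            exact_mod_cast Nat.factorial_le (Nat.le_add_left j k)
          calc c * c' / β ^ k * (l * F / β) ^ j
              ≤ c * c' / β ^ k * (l * F / β) ^ j * ((k + j).factorial / j.factorial) :=
                le_mul_of_one_le_right (by positivity) hfac
            _ = _ := by
                rw [pow_add, div_pow, mul_pow]
                field_simp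
      _ ≤ ENNReal.ofReal (c * l ^ j * (F ^ j / j.factorial)) *
          ∫⁻ x : Space n, ENNReal.ofReal (Real.exp (-κ * ‖x‖) * profile R M ω (k + j) x) :=
          mul_le_mul_right (hc' (k + j)) _
      _ ≤ _ := by
          rw [← lintegral_const_mul' _ _ ENNReal.ofReal_ne_top]
          refine lintegral_mono_ae ?_
          filter_upwards [hj] with x hx
          calc _ = ENNReal.ofReal (Real.exp (-κ * ‖x‖)) * ENNReal.ofReal
                (c * l ^ j * (F ^ j / j.factorial) * profile R M ω (k + j) x) := by
                rw [← ENNReal.ofReal_mul (by positivity), ← ENNReal.ofReal_mul (by positivity)]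
                ring_nf
            _ ≤ _ := mul_le_mul_right hx _
  have htend : Tendsto (fun j : ℕ => c * c' / β ^ k * (l * F / β) ^ j) atTop atTop :=
    (tendsto_pow_atTop_atTop_of_one_lt hgrow).const_mul_atTop (by positivity)
  exact top_le_iff.mp (le_of_tendsto' (ENNReal.tendsto_ofReal_atTop.comp htend) hlow)

/-! ### Consequences of the growth hypotheses -/

theorem one_le_threshold (α δ : ℝ) : 1 ≤ threshold α δ := by
  unfold threshold
  split_ifs
  · exact le_rfl
  · linarith [min_le_right δ 0]

/-- The decay rate of the initial datum is at most any number above `threshold α δ - 1`. -/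
theorem InitialGrowth.exists_exp_le {n : ℕ} {u₀ : Space n → ℝ} {α δ η : ℝ}
    (h : InitialGrowth u₀ α δ) (hpos : ∀ᵐ x, 0 < u₀ x) (hα : α ≤ 1)
    (hη : threshold α δ < 1 + η) :
    ∃ R : ℝ, 0 < R ∧ ∀ R' ≥ R, ∀ᵐ x : Space n, R' ≤ ‖x‖ → Real.exp (-η * ‖x‖) ≤ u₀ x := by
  obtain ⟨R₁, hR₁, hu⟩ := h
  obtain ⟨R₂, hR₂⟩ : ∃ R₂ : ℝ, ∀ r : ℝ, 0 < r → R₂ ≤ r → -η * r ≤ δ * r ^ α := by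
    rcases hα.lt_or_eq with hα | rfl
    · have hη0 : 0 < η := by
        simp only [threshold, if_pos hα] at hη
        linarith
      have ht : Tendsto (fun r : ℝ => δ * r ^ (-(1 - α))) atTop (𝓝 (δ * 0)) :=
        (tendsto_rpow_neg_atTop (sub_pos.mpr hα)).const_mul δ
      rw [mul_zero] at ht
      obtain ⟨R₂, hR₂⟩ := eventually_atTop.mp (ht.eventually_const_lt (neg_lt_zero.mpr hη0))
      refine ⟨R₂, fun r hr hr' => ?_⟩
      have h1 := mul_le_mul_of_nonneg_right (hR₂ r hr').le hr.le
      rwa [mul_assoc, ← Real.rpow_add_one hr.ne', show -(1 - α) + 1 = α by ring] at h1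
    · refine ⟨0, fun r hr _ => ?_⟩
      simp only [threshold, lt_irrefl, if_false] at hη
      rw [Real.rpow_one]
      have := min_le_left δ 0
      exact mul_le_mul_of_nonneg_right (by linarith) hr.le
  refine ⟨max R₁ R₂, lt_max_of_lt_left hR₁, fun R' hR' => ?_⟩
  filter_upwards [hu, hpos] with x hx hx0 hxR
  have h1 : R₁ ≤ ‖x‖ := (le_max_left _ _).trans (hR'.trans hxR)
  have h2 : R₂ ≤ ‖x‖ := (le_max_right _ _).trans (hR'.trans hxR)
  have hr : 0 < ‖x‖ := hR₁.trans_le h1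
  rw [← Real.le_log_iff_exp_le hx0]
  exact (hR₂ _ hr h2).trans ((le_div_iff₀ (Real.rpow_pos_of_pos hr α)).mp (hx h1))

theorem PotentialGrowth.intervalIntegrable {n : ℕ} {a : Space n → ℝ → ℝ} {Λ : ℝ → ℝ} {σ R₀ : ℝ}
    (h : PotentialGrowth a Λ σ R₀) {b : ℝ} (hb : 0 ≤ b) : IntervalIntegrable Λ volume 0 b := by
  obtain ⟨K, hK⟩ := h.locallyBounded b
  rw [intervalIntegrable_iff_integrableOn_Ioc_of_le hb]
  refine Integrable.of_bound
    (h.aemeasurable.mono_set Ioc_subset_Ioi_self).aestronglyMeasurable K ?_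
  filter_upwards [ae_restrict_mem measurableSet_Ioc] with t ht
  rw [Real.norm_of_nonneg (h.pos t ht.1).le]
  exact hK t ht

theorem primitiveΛ_eq_intervalIntegral (Λ : ℝ → ℝ) {t : ℝ} (ht : 0 ≤ t) :
    primitiveΛ Λ t = ∫ s in (0 : ℝ)..t, Λ s := by
  rw [primitiveΛ, restrict_Ioo_eq_restrict_Ioc, intervalIntegral.integral_of_le ht]

theorem PotentialGrowth.mul_excess_le {n : ℕ} {a : Space n → ℝ → ℝ} {Λ : ℝ → ℝ} {σ R₀ : ℝ}
    (h : PotentialGrowth a Λ σ R₀) (ha : ∀ t, 0 < t → ∀ x, 0 ≤ a x t) {A R : ℝ} (hR : 0 ≤ R)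
    (hR₀ : R₀ ≤ R) (hA : 0 ≤ A) (hAR : ∀ r ≥ R, A * r ≤ r ^ σ) {t : ℝ} (ht : 0 < t)
    (y : Space n) : A * Λ t * excess R y ≤ a y t + 1 := by
  have hΛ := (h.pos t ht).le
  rcases le_total R ‖y‖ with hy | hy
  · have h1 := h.bound t ht y (hR₀.trans hy)
    have h2 := mul_le_mul_of_nonneg_left (hAR _ hy) hΛ
    have h3 : excess R y ≤ ‖y‖ := max_le (by linarith) (norm_nonneg y)
    have h4 := mul_le_mul_of_nonneg_left h3 (mul_nonneg hA hΛ)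
    linarith
  · rw [excess, max_eq_right (by linarith), mul_zero]
    linarith [ha t ht y]

/-! ### Solutions and extended solutions as supersolutions -/

theorem mem_timeInterval_of_le {T : EReal} {s t : ℝ} (ht : t ∈ timeInterval T) (hs : 0 ≤ s)
    (hst : s ≤ t) : s ∈ timeInterval T :=
  ⟨hs, lt_of_le_of_lt (EReal.coe_le_coe_iff.mpr hst) ht.2⟩

theorem IsSolution.isSupersolution {n : ℕ} {a : Space n → ℝ → ℝ} {u₀ : Space n → ℝ} {T : EReal}
    {u : ℝ → Space n → ℝ} (hu : IsSolution a u₀ T u) (hnn : IsNonneg T u)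
    (ha : ∀ t, 0 < t → ∀ x, 0 ≤ a x t) (hpos : ∀ᵐ x, 0 < u₀ x) {b : ℝ}
    (hb : b ∈ timeInterval T) :
    IsSupersolution a u₀ b (fun t x => ENNReal.ofReal (Real.exp t * u t x)) := by
  intro t ht
  filter_upwards [hu.mild t (mem_timeInterval_of_le hb ht.1 ht.2), hpos] with x hx hx0
  obtain ⟨h1, h2, h3⟩ := hx
  have hae : ∀ τ ∈ Ioo 0 t, ∀ᵐ y : Space n,
      0 ≤ (a y τ + 1) * (Real.exp τ * u τ y) := by
    intro τ hτ
    filter_upwards [hnn τ (mem_timeInterval_of_le hb hτ.1.le (hτ.2.le.trans ht.2))] with y hy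
    have := ha τ hτ.1 y
    positivity
  have hae' : ∀ τ ∈ Ioo 0 t, ∀ᵐ y : Space n,
      0 ≤ besselKernel (x - y) * ((a y τ + 1) * (Real.exp τ * u τ y)) := by
    intro τ hτ
    filter_upwards [hae τ hτ] with y hy using mul_nonneg (besselKernel_nonneg _) hy
  have hop : 0 ≤ᵐ[volume.restrict (Ioo 0 t)]
      fun τ => besselOp (fun y => (a y τ + 1) * (Real.exp τ * u τ y)) x := by
    filter_upwards [ae_restrict_mem measurableSet_Ioo] with τ hτ
    exact integral_nonneg_of_ae (hae' τ hτ)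
  rw [h3, ENNReal.ofReal_add hx0.le (integral_nonneg_of_ae hop),
    ofReal_integral_eq_lintegral_ofReal h2 hop]
  refine add_le_add le_rfl (lintegral_mono_ae ?_)
  filter_upwards [h1, ae_restrict_mem measurableSet_Ioo] with τ hτ hτm
  rw [besselOp, ofReal_integral_eq_lintegral_ofReal hτ (hae' τ hτm)]
  refine lintegral_mono fun y => le_of_eq ?_
  have := ha τ hτm.1 y
  rw [← ENNReal.ofReal_mul (mul_nonneg (besselKernel_nonneg _) (by linarith)), mul_assoc]

theorem ContinuousInE.lintegral_exp_ne_top {n : ℕ} {T : EReal} {u : ℝ → Space n → ℝ}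
    (hu : ContinuousInE T u) {b : ℝ} (hb : b ∈ timeInterval T) {κ : ℝ} (hκ : 1 ≤ κ) :
    ∫⁻ x, ENNReal.ofReal (Real.exp (-κ * ‖x‖)) * ENNReal.ofReal (Real.exp b * u b x) ≠ ⊤ := by
  obtain ⟨ρ, -, hρ, hmem, -⟩ := hu b hb
  have hint : Integrable fun x => Real.exp (-ρ * ‖x‖) * u b x := hmem b ⟨hb.1, le_rfl⟩
  refine ne_top_of_le_ne_top (ENNReal.mul_ne_top (ENNReal.ofReal_ne_top (r := Real.exp b))
    hint.hasFiniteIntegral.ne) ?_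
  rw [← lintegral_const_mul' _ _ ENNReal.ofReal_ne_top]
  refine lintegral_mono fun x => ?_
  rw [← ofReal_norm, ← ENNReal.ofReal_mul (by positivity),
    ← ENNReal.ofReal_mul (by positivity), norm_mul, Real.norm_of_nonneg (Real.exp_pos _).le]
  apply ENNReal.ofReal_le_ofReal
  have h1 : Real.exp (-κ * ‖x‖) ≤ Real.exp (-ρ * ‖x‖) :=
    Real.exp_le_exp.mpr (mul_le_mul_of_nonneg_right (by linarith) (norm_nonneg x))
  calc _ = Real.exp b * (Real.exp (-κ * ‖x‖) * u b x) := by ring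
    _ ≤ Real.exp b * (Real.exp (-ρ * ‖x‖) * ‖u b x‖) := by
        refine mul_le_mul_of_nonneg_left ?_ (Real.exp_pos b).le
        exact (mul_le_mul_of_nonneg_left (Real.le_norm_self _) (Real.exp_pos _).le).trans
          (mul_le_mul_of_nonneg_right h1 (norm_nonneg _))

theorem IsExtendedSolution.isSupersolution {n : ℕ} {a : Space n → ℝ → ℝ} {u₀ : Space n → ℝ}
    {T : EReal} {U : ℝ → Space n → ENNReal} (hU : IsExtendedSolution a u₀ T U) {b : ℝ}
    (hb : b ∈ timeInterval T) :
    IsSupersolution a u₀ b (fun t x => ENNReal.ofReal (Real.exp t) * U t x) := fun t ht =>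
  ae_of_all _ fun x => (hU.mild t (mem_timeInterval_of_le hb ht.1 ht.2) x).ge

/-! ### Complete blow-up and nonexistence -/

/-- Convolution with the Bessel kernel is infinite everywhere on functions with infinite integral
against `exp (-2 |x|)`. -/
theorem lintegral_besselKernel_mul_eq_top {n : ℕ} (hn : 0 < n) {g : Space n → ENNReal}
    (hg : ∫⁻ y, ENNReal.ofReal (Real.exp (-2 * ‖y‖)) * g y = ⊤) (x : Space n) :
    ∫⁻ y, ENNReal.ofReal (besselKernel (x - y)) * g y = ⊤ := by
  obtain ⟨c, hc, hle⟩ := exists_exp_le_heatMixture hn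
  have hqp := (Measure.measurePreserving_sub_left (volume : Measure (Space n)) x)
  rw [← top_le_iff]
  calc (⊤ : ENNReal) = ENNReal.ofReal (c * Real.exp (-2 * ‖x‖)) *
        ∫⁻ y, ENNReal.ofReal (Real.exp (-2 * ‖y‖)) * g y := by
        rw [hg, ENNReal.mul_top]
        simpa using (by positivity : 0 < c * Real.exp (-2 * ‖x‖))
    _ ≤ _ := by
        rw [← lintegral_const_mul' _ _ ENNReal.ofReal_ne_top]
        refine lintegral_mono_ae ?_
        filter_upwards [hqp.quasiMeasurePreserving.ae (ofReal_besselKernel_ae hn)] with y hy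
        rw [hy, ← mul_assoc, ← ENNReal.ofReal_mul (by positivity)]
        refine mul_le_mul_left ((ENNReal.ofReal_le_ofReal ?_).trans (hle (x - y))) _
        rw [mul_assoc, ← Real.exp_add]
        have := norm_sub_le x y
        gcongr
        linarith

/-- For `σ > 1`, every supersolution has infinite integral against `exp (-2 |x|)` at all positive
times: beyond a large radius `|x|^σ` exceeds any multiple of `|x|`. -/
theorem IsSupersolution.lintegral_exp_two_eq_top {n : ℕ} (hn : 0 < n) {a : Space n → ℝ → ℝ}
    {Λ : ℝ → ℝ} {σ R₀ α δ : ℝ} {u₀ : Space n → ℝ} (ha : ∀ t, 0 < t → ∀ x, 0 ≤ a x t)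
    (hΛ : PotentialGrowth a Λ σ R₀) (hpos : ∀ᵐ x, 0 < u₀ x) (hα : α ≤ 1)
    (hgrowth : InitialGrowth u₀ α δ) (hσ : 1 < σ) {b : ℝ} (hb : 0 < b)
    {m : ℝ → Space n → ENNReal} (hm : IsSupersolution a u₀ b m) :
    ∫⁻ x, ENNReal.ofReal (Real.exp (-2 * ‖x‖)) * m b x = ⊤ := by
  have hint := hΛ.intervalIntegrable hb.le
  have hL : 0 < ∫ s in (0 : ℝ)..b, Λ s :=
    intervalIntegral.intervalIntegral_pos_of_pos_on hint (fun s hs => hΛ.pos s hs.1) hb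
  set L := ∫ s in (0 : ℝ)..b, Λ s with hLdef
  set η := threshold α δ with hη
  have hη1 : 1 ≤ η := one_le_threshold α δ
  obtain ⟨R₁, hR₁, hu⟩ := hgrowth.exists_exp_le (η := η) hpos hα (by linarith)
  set A := (3 + η) / L with hA
  have hA0 : 0 < A := by positivity
  set R := max R₁ (max R₀ (A ^ (σ - 1)⁻¹)) with hR
  have hRpos : 0 < R := lt_max_of_lt_left hR₁
  have hAR : ∀ r ≥ R, A * r ≤ r ^ σ := by
    intro r hr
    have hr0 : 0 < r := hRpos.trans_le hr
    have h1 : A ^ (σ - 1)⁻¹ ≤ r := ((le_max_right _ _).trans (le_max_right _ _)).trans hr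
    have h2 : A ≤ r ^ (σ - 1) := by
      have := Real.rpow_le_rpow (by positivity) h1 (sub_pos.mpr hσ).le
      rwa [← Real.rpow_mul hA0.le, inv_mul_cancel₀ (sub_pos.mpr hσ).ne', Real.rpow_one] at this
    calc A * r ≤ r ^ (σ - 1) * r := by gcongr
      _ = r ^ σ := by rw [← Real.rpow_add_one hr0.ne', sub_add_cancel]
  refine hm.lintegral_exp_eq_top hn hb.le (f := fun t => A * Λ t) (hint.const_mul A)
    (fun τ hτ => mul_nonneg hA0.le (hΛ.pos τ hτ.1).le) hRpos
    (fun τ hτ y => hΛ.mul_excess_le ha hRpos.le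
      ((le_max_left _ _).trans (le_max_right _ _)) hA0.le hAR hτ.1 y)
    (by linarith) two_pos hpos (hu R (le_max_left _ _)) ?_
  rw [intervalIntegral.integral_const_mul, ← hLdef, hA, div_mul_cancel₀ _ hL.ne']
  linarith

end Pseudoparabolic

end

theorem mainTheorem1 {n : ℕ} (hn : 0 < n)
    (a : Pseudoparabolic.Space n → ℝ → ℝ) (Λ : ℝ → ℝ) (σ R₀ α δ : ℝ)
    (u₀ : Pseudoparabolic.Space n → ℝ)
    (ha : ∀ t, 0 < t → ∀ x, 0 ≤ a x t)
    (hR₀ : 0 ≤ R₀)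
    (h1 : Pseudoparabolic.PotentialGrowth a Λ σ R₀)
    (h3 : ∀ᵐ x, 0 < u₀ x)
    (hα : α ≤ 1) (hδ : α = 1 → δ < 1)
    (hgrowth : Pseudoparabolic.InitialGrowth u₀ α δ) :
    (1 < σ → ∀ T : EReal, 0 < T →
      (¬ ∃ u : ℝ → Pseudoparabolic.Space n → ℝ,
        Pseudoparabolic.IsSolution a u₀ T u ∧ Pseudoparabolic.IsNonneg T u) ∧
      ∀ U : ℝ → Pseudoparabolic.Space n → ENNReal,
        Pseudoparabolic.IsExtendedSolution a u₀ T U →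
          Pseudoparabolic.BlowsUpCompletely T U) ∧
    (σ = 1 →
      ENNReal.ofReal (Pseudoparabolic.threshold α δ) <
        (⨆ τ ∈ Ioi (0 : ℝ), Pseudoparabolic.cConst Λ σ R₀ τ *
          ENNReal.ofReal (Pseudoparabolic.primitiveΛ Λ τ)) →
      ¬ ∃ u : ℝ → Pseudoparabolic.Space n → ℝ,
        Pseudoparabolic.IsSolution a u₀ ⊤ u ∧ Pseudoparabolic.IsNonneg ⊤ u) := by
  open Pseudoparabolic in
  refine ⟨fun hσ T hT => ⟨?_, ?_⟩, ?_⟩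
  · rintro ⟨u, hu, hnn⟩
    obtain ⟨b, hb0, hbT⟩ := EReal.lt_iff_exists_real_btwn.mp hT
    have hb : 0 < b := by exact_mod_cast hb0
    have hbm : b ∈ timeInterval T := ⟨hb.le, hbT⟩
    exact hu.continuous.lintegral_exp_ne_top hbm one_le_two
      ((hu.isSupersolution hnn ha h3 hbm).lintegral_exp_two_eq_top hn ha h1 h3 hα hgrowth hσ hb)
  · intro U hU t ht ht0 x
    have hinner : ∀ τ ∈ Ioo 0 t, ∫⁻ y, ENNReal.ofReal (besselKernel (x - y) * (a y τ + 1)) *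
        (ENNReal.ofReal (Real.exp τ) * U τ y) = ⊤ := by
      intro τ hτ
      have hsup := hU.isSupersolution (mem_timeInterval_of_le ht hτ.1.le hτ.2.le)
      rw [← top_le_iff, ← lintegral_besselKernel_mul_eq_top hn
        (hsup.lintegral_exp_two_eq_top hn ha h1 h3 hα hgrowth hσ hτ.1) x]
      gcongr with y
      exact le_mul_of_one_le_right (besselKernel_nonneg _) (by linarith [ha τ hτ.1 y])
    have hmild := hU.mild t ht x
    rw [setLIntegral_congr_fun measurableSet_Ioo hinner, setLIntegral_const, Real.volume_Ioo,
      ENNReal.top_mul (by simpa using ht0), add_top, ENNReal.mul_eq_top] at hmild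
    rcases hmild with h | h
    · exact h.2
    · exact absurd h.1 ENNReal.ofReal_ne_top
  · rintro rfl hsup ⟨u, hu, hnn⟩
    obtain ⟨b, hb⟩ := lt_iSup_iff.mp hsup
    obtain ⟨hb0, hlt⟩ := lt_iSup_iff.mp hb
    have hb0 : 0 < b := hb0
    have hthr : threshold α δ < ∫ s in (0 : ℝ)..b, Λ s := by
      rw [← primitiveΛ_eq_intervalIntegral Λ hb0.le]
      refine lt_of_not_ge fun hcon => absurd hlt (not_lt.mpr ?_)
      calc _ ≤ 1 * ENNReal.ofReal (primitiveΛ Λ b) := by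
            gcongr
            exact min_le_left _ _
        _ ≤ _ := by
            rw [one_mul]
            exact ENNReal.ofReal_le_ofReal hcon
    obtain ⟨θ, hθ1, hθ2⟩ := exists_between hthr
    obtain ⟨R₁, hR₁, hu₀⟩ := hgrowth.exists_exp_le (η := θ - 1) h3 hα (by linarith)
    have hbm : b ∈ timeInterval ⊤ := ⟨hb0.le, EReal.coe_lt_top b⟩
    have hRpos : 0 < max R₁ R₀ := lt_max_of_lt_left hR₁
    refine hu.continuous.lintegral_exp_ne_top hbm le_rfl
      ((hu.isSupersolution hnn ha h3 hbm).lintegral_exp_eq_top hn hb0.le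
        (h1.intervalIntegrable hb0.le) (fun τ hτ => (h1.pos τ hτ.1).le) hRpos (fun τ hτ y => ?_)
        (by linarith [one_le_threshold α δ]) one_pos h3 (hu₀ _ (le_max_left _ _)) (by linarith))
    have := h1.mul_excess_le ha (A := 1) hRpos.le (le_max_right _ _) zero_le_one
      (fun r _ => by simp) hτ.1 y
    rwa [one_mul] at this
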